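/- Let $m,n\ge 1$ be integers, let $0<\alpha_k<n$ for $k=1,\dots,m$, put $\alpha=\sum_{k=1}^m\alpha_k$, and assume $mn-\alpha<n$. Let $2\le q\le \frac{2n}{mn-\alpha}$ and $\frac1q+\frac1p=1$. For a complex-valued Schwartz function $f\in\mathcal S(\mathbb R^{mn})$, written $f(x_1,\dots,x_m)$ with $x_k\in\mathbb R^n$, let $$\Lambda_*(f;\alpha_1,\dots,\alpha_m)=\int_{\mathbb R^n\times\cdots\times\mathbb R^n}\Big|\prod_{k=1}^m(1-\Delta_k)^{\alpha_k/4}f\Big|^2dx_1\cdots dx_m ,$$ where $\Delta_k$ is the Laplacian in $x_k$ and $\prod_k(1-\Delta_k)^{\alpha_k/4}$ is the Fourier multiplier with symbol $\prod_k(1+4\pi^2|\xi_k|^2)^{\alpha_k/4}$ for the Fourier transform $\widehat f(\xi)=\int e^{-2\pi i x\cdot\xi}f(x)\,dx$. For $a>0$ let $$G_a(x)=\frac1{(4\pi)^{a/2}\Gamma(a/2)}\int_0^\infty e^{-\pi|x|^2/\delta}e^{-\delta/4\pi}\delta^{-(n-a)/2}\,\frac{d\delta}{\delta},\qquad x\in\mathbb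 R^n,$$ be the Bessel potential on $\mathbb R^n$. Then there is a finite constant $C_{\alpha,q}>0$, depending only on $m,n,\alpha_1,\dots,\alpha_m$ and $q$, such that $$\Big[\int_{\mathbb R^n}|f(x,\dots,x)|^q\,dx\Big]^{2/q}\le C_{\alpha,q}\,\Lambda_*(f;\alpha_1,\dots,\alpha_m)\qquad\text{for all } f\in\mathcal S(\mathbb R^{mn}),\tag{1}$$ and, for every complex-valued $h\in L^p(\mathbb R^n)$, the following double integral converges absolutely and $$\Big|\int_{\mathbb R^n\times\mathbb R^n}h(x)\prod_{k=1}^mG_{\alpha_k}(x-w)\,h(w)\,dx\,dw\Big|\le C_{\alpha,q}\,\|h\|_{L^p(\mathbb R^n)}^2 .\tag{2}$$ Moreover, the two inequalities are equivalent with the same constant: a real number $C$ is admissible in place of $C_{\alpha,q}$ in (1) for all $f$ if and only if it is admissible in (2) (including absolute convergence) for all $h$. -/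

import Mathlib

open MeasureTheory
open scoped FourierTransform SchwartzMap

noncomputable section

/-- `ℝⁿ` with its Euclidean norm and Lebesgue measure. -/
abbrev Rn (n : ℕ) : Type := EuclideanSpace ℝ (Fin n)

/-- `ℝ^{mn} = ℝⁿ × ⋯ × ℝⁿ` (`m` slots) with its Euclidean norm and Lebesgue measure;
the `k`-th slot of `x` is `x k`. -/
abbrev Rmn (m n : ℕ) : Type := PiLp 2 (fun _ : Fin m => Rn n)

/-- The diagonal point `(x, …, x)`. -/
def diag (m n : ℕ) (x : Rn n) : Rmn m n := WithLp.toLp 2 (fun _ => x)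

/-- The symbol `∏ₖ (1 + 4π²|ξₖ|²)^{αₖ/4}` of `∏ₖ (1 - Δₖ)^{αₖ/4}`, for the Fourier transform
with kernel `exp(-2πi⟨x, ξ⟩)`. -/
def besselSymbol {m n : ℕ} (α : Fin m → ℝ) (ξ : Rmn m n) : ℝ :=
  ∏ k, (1 + 4 * Real.pi ^ 2 * ‖ξ k‖ ^ 2) ^ (α k / 4)

/-- `∏ₖ (1 - Δₖ)^{αₖ/4} f`, where `Δₖ` is the Laplacian in the `k`-th slot. -/
def besselOp {m n : ℕ} (α : Fin m → ℝ) (f : 𝓢(Rmn m n, ℂ)) : Rmn m n → ℂ :=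
  𝓕⁻ (fun ξ : Rmn m n => (besselSymbol α ξ : ℂ) * 𝓕 (f : Rmn m n → ℂ) ξ)

/-- `Λ_*(f; α₁, …, αₘ) = ∫ |∏ₖ (1 - Δₖ)^{αₖ/4} f|² dx₁ ⋯ dxₘ`. -/
def lambdaStar {m n : ℕ} (α : Fin m → ℝ) (f : 𝓢(Rmn m n, ℂ)) : ℝ :=
  ∫ x : Rmn m n, ‖besselOp α f x‖ ^ 2

/-- The Bessel potential `G_a` on `ℝⁿ`. -/
def besselG (n : ℕ) (a : ℝ) (x : Rn n) : ℝ :=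
  1 / ((4 * Real.pi) ^ (a / 2) * Real.Gamma (a / 2)) *
    ∫ δ in Set.Ioi (0 : ℝ),
      Real.exp (-Real.pi * ‖x‖ ^ 2 / δ) * Real.exp (-δ / (4 * Real.pi)) *
        δ ^ (-((n : ℝ) - a) / 2) * (1 / δ)

/-- The trace inequality with constant `C`:
`[∫ |f(x, …, x)|^q dx]^{2/q} ≤ C Λ_*(f; α₁, …, αₘ)` for all Schwartz `f` on `ℝ^{mn}`. -/
def DiagonalTraceBound (m n : ℕ) (α : Fin m → ℝ) (q C : ℝ) : Prop :=
  ∀ f : 𝓢(Rmn m n, ℂ),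
    (∫ x : Rn n, ‖f (diag m n x)‖ ^ q) ^ (2 / q) ≤ C * lambdaStar α f

/-- The bilinear inequality with constant `C`: for all `h ∈ L^p(ℝⁿ)`, the double integral
`∫∫ h(x) ∏ₖ G_{αₖ}(x - w) h(w) dx dw` converges absolutely, with modulus at most `C ‖h‖_p²`. -/
def BesselFormBound (m n : ℕ) (α : Fin m → ℝ) (p C : ℝ) : Prop :=
  ∀ h : Rn n → ℂ, MemLp h (ENNReal.ofReal p) volume →
    Integrable (fun z : Rn n × Rn n =>
      h z.1 * ((∏ k, besselG n (α k) (z.1 - z.2) : ℝ) : ℂ) * h z.2) (volume.prod volume) ∧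
    ‖∫ z : Rn n × Rn n,
        h z.1 * ((∏ k, besselG n (α k) (z.1 - z.2) : ℝ) : ℂ) * h z.2 ∂(volume.prod volume)‖ ≤
      C * (eLpNorm h (ENNReal.ofReal p) volume).toReal ^ 2

end

open MeasureTheory
open scoped FourierTransform SchwartzMap ENNReal

noncomputable section

namespace BesselTrace

/-! The equivalence is a `T T*` argument for the restriction `T f (x) = f(x, …, x)`. By Fourier
inversion, `∫ f(x, …, x) h(x) dx = ∫ f̂(ξ) ȟ(ξ₁ + ⋯ + ξₘ) dξ`. Cauchy–Schwarz with the weight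
`besselSymbol` bounds the squared modulus by `Λ_*(f) E(h)`, where `E(h) = ∫ ∏ₖ (1 +
4π²|ξₖ|²)^{-αₖ/2} |ȟ(∑ ξₖ)|² dξ` is `energyE`.

The energy is the Bessel form of `h` with the second factor conjugated. Indeed `G_a` is a mixture of
the Gaussians `δ^{-n/2} exp(-π|x|²/δ)` under a Gamma law in `δ`, and the same law applied to
`exp(-πδ|ξ|²)` produces `(1 + 4π²|ξ|²)^{-a/2}`. For fixed `δ` Fubini is harmless; integrating over
`δ` is then Tonelli. Since the kernel is nonnegative, `E(h)` is at most the form of `|h|`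
(`energyE_le_formE`), with equality for `h ≥ 0` (`energyE_eq_formE`).

A form bound gives the trace bound by testing against the Hölder extremal of the trace
(`diagonalTraceBound_of_formE_le`). Conversely, taking `f̂` to be a cutoff of the Cauchy–Schwarz
extremal bounds the energy of nice `h ≥ 0` (`formE_le_of_bounded`), and monotone approximation
reaches all of `L^p`. No constant is lost either way.

It remains to prove one of the bounds. The kernel `∏ₖ G_{αₖ}` is at most `C |x|^{-s}` for every `s ≥
mn - α`. With `s = 2n/q` this is the Hardy–Littlewood–Sobolev situation when `q > 2`; for `q = 2`
the kernel is integrable because `mn - α < n`. Both cases go through `lintegral_kernel_form_le`. -/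

/-! ### Bessel potentials as Gamma mixtures of Gaussians -/

/-- The law of the mixing parameter `δ` in the Bessel potential `G_a`. -/
def mixLaw (a : ℝ) : Measure ℝ := ProbabilityTheory.gammaMeasure (a / 2) (1 / (4 * Real.pi))

lemma isProbabilityMeasure_mixLaw {a : ℝ} (ha : 0 < a) : IsProbabilityMeasure (mixLaw a) :=
  ProbabilityTheory.isProbabilityMeasure_gammaMeasure (by positivity) (by positivity)

/-- The density of `mixLaw a` on the positive half-line. -/
def mixDensity (a δ : ℝ) : ℝ :=
  (1 / (4 * Real.pi)) ^ (a / 2) / Real.Gamma (a / 2) * δ ^ (a / 2 - 1) *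
    Real.exp (-(1 / (4 * Real.pi) * δ))

lemma mixDensity_nonneg {a δ : ℝ} (ha : 0 < a) (hδ : 0 < δ) : 0 ≤ mixDensity a δ := by
  have := Real.Gamma_pos_of_pos (show 0 < a / 2 by positivity)
  unfold mixDensity; positivity

@[fun_prop]
lemma measurable_mixDensity (a : ℝ) : Measurable (mixDensity a) := by
  unfold mixDensity; fun_prop

lemma lintegral_mixLaw (a : ℝ) {f : ℝ → ℝ≥0∞} (hf : Measurable f) :
    ∫⁻ δ, f δ ∂(mixLaw a) =
      ∫⁻ δ in Set.Ioi (0 : ℝ), ENNReal.ofReal (mixDensity a δ) * f δ := by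
  have hm : Measurable (ProbabilityTheory.gammaPDF (a / 2) (1 / (4 * Real.pi))) :=
    (ProbabilityTheory.measurable_gammaPDFReal _ _).ennreal_ofReal
  rw [mixLaw, ProbabilityTheory.gammaMeasure, lintegral_withDensity_eq_lintegral_mul _ hm hf,
    ← lintegral_indicator measurableSet_Ioi]
  refine lintegral_congr_ae ?_
  have h0 : ∀ᵐ δ : ℝ, δ ≠ 0 := by simp [ae_iff]
  filter_upwards [h0] with δ hδ
  by_cases h : 0 < δ
  · simp [h, h.le, ProbabilityTheory.gammaPDF, ProbabilityTheory.gammaPDFReal, mixDensity]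
  · have : ¬ 0 ≤ δ := fun h' => h (lt_of_le_of_ne h' (Ne.symm hδ))
    simp [h, this, ProbabilityTheory.gammaPDF, ProbabilityTheory.gammaPDFReal]

lemma ae_pos_mixLaw (a : ℝ) : ∀ᵐ δ ∂(mixLaw a), 0 < δ := by
  have h := lintegral_mixLaw a (f := Set.indicator (Set.Iic (0 : ℝ)) 1)
    (measurable_one.indicator measurableSet_Iic)
  rw [lintegral_indicator_one measurableSet_Iic] at h
  have h2 : ∫⁻ δ in Set.Ioi (0 : ℝ), ENNReal.ofReal (mixDensity a δ) *
      Set.indicator (Set.Iic (0 : ℝ)) 1 δ = 0 := by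
    rw [setLIntegral_congr_fun (g := fun _ => 0) measurableSet_Ioi]
    · simp
    · intro δ hδ
      simp [Set.indicator, not_le.2 (Set.mem_Ioi.1 hδ)]
  rw [h2] at h
  rw [ae_iff]
  convert h using 3
  ext; simp

/-- The Gaussian `δ^{-n/2} exp(-π|x|²/δ)`. -/
def gaussKernel (n : ℕ) (δ : ℝ) (x : Rn n) : ℝ :=
  δ ^ (-(n : ℝ) / 2) * Real.exp (-Real.pi * ‖x‖ ^ 2 / δ)

lemma gaussKernel_nonneg (n : ℕ) {δ : ℝ} (hδ : 0 ≤ δ) (x : Rn n) : 0 ≤ gaussKernel n δ x := by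
  unfold gaussKernel; positivity

@[fun_prop]
lemma measurable_gaussKernel (n : ℕ) :
    Measurable (fun z : ℝ × Rn n => gaussKernel n z.1 z.2) := by
  unfold gaussKernel; fun_prop

/-- The Bessel potential as an `ℝ≥0∞`-valued function. -/
def besselE (n : ℕ) (a : ℝ) (x : Rn n) : ℝ≥0∞ :=
  ∫⁻ δ, ENNReal.ofReal (gaussKernel n δ x) ∂(mixLaw a)

@[fun_prop]
lemma measurable_besselE (n : ℕ) {a : ℝ} (ha : 0 < a) : Measurable (besselE n a) := by
  have := isProbabilityMeasure_mixLaw ha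
  unfold besselE
  refine Measurable.lintegral_prod_left' (f := fun z : ℝ × Rn n =>
    ENNReal.ofReal (gaussKernel n z.1 z.2)) ?_
  fun_prop

lemma besselE_neg (n : ℕ) (a : ℝ) (x : Rn n) : besselE n a (-x) = besselE n a x := by
  simp [besselE, gaussKernel]

lemma mixDensity_mul_gaussKernel (n : ℕ) (a : ℝ) {δ : ℝ} (hδ : 0 < δ) (x : Rn n) :
    mixDensity a δ * gaussKernel n δ x =
      1 / ((4 * Real.pi) ^ (a / 2) * Real.Gamma (a / 2)) *
      (Real.exp (-Real.pi * ‖x‖ ^ 2 / δ) * Real.exp (-δ / (4 * Real.pi)) *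
        δ ^ (-((n : ℝ) - a) / 2) * (1 / δ)) := by
  have e1 : δ ^ (-((n : ℝ) - a) / 2) * (1 / δ) = δ ^ (a / 2 - 1) * δ ^ (-(n : ℝ) / 2) := by
    rw [one_div, ← Real.rpow_neg_one δ, ← Real.rpow_add hδ, ← Real.rpow_add hδ]
    ring_nf
  have e2 : (1 / (4 * Real.pi)) ^ (a / 2) = ((4 * Real.pi) ^ (a / 2))⁻¹ := by
    rw [one_div, Real.inv_rpow (by positivity)]
  have e3 : -(1 / (4 * Real.pi) * δ) = -δ / (4 * Real.pi) := by ring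
  unfold mixDensity gaussKernel
  rw [mul_assoc (Real.exp _ * Real.exp _), e1, e2, e3, one_div, mul_inv]
  ring

/-- No finiteness is needed: where the mixture diverges, as at `x = 0` when `a < n`, the Bochner
integral and `toReal` both take the value `0`. -/
lemma besselG_eq_toReal (n : ℕ) {a : ℝ} (ha : 0 < a) (x : Rn n) :
    besselG n a x = (besselE n a x).toReal := by
  rw [besselE, lintegral_mixLaw a (by unfold gaussKernel; fun_prop), besselG,
    ← integral_const_mul, integral_eq_lintegral_of_nonneg_ae]
  · congr 1
    refine setLIntegral_congr_fun measurableSet_Ioi fun δ hδ => ?_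
    rw [← ENNReal.ofReal_mul (mixDensity_nonneg ha hδ), ← mixDensity_mul_gaussKernel n a hδ]
  · refine (ae_restrict_iff' measurableSet_Ioi).2 (Filter.Eventually.of_forall fun δ hδ => ?_)
    dsimp only
    rw [← mixDensity_mul_gaussKernel n a hδ]
    exact mul_nonneg (mixDensity_nonneg ha hδ) (gaussKernel_nonneg n (le_of_lt hδ) x)
  · exact Measurable.aestronglyMeasurable (by fun_prop)

/-- The substitution `t = 1/δ` turns this into the Gamma integral. -/
lemma lintegral_exp_neg_div_mul_rpow {s b : ℝ} (hs : 0 < s) (hb : 0 < b) :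
    ∫⁻ δ in Set.Ioi (0 : ℝ), ENNReal.ofReal (Real.exp (-b / δ) * δ ^ (-s - 1)) =
      ENNReal.ofReal ((1 / b) ^ s * Real.Gamma s) := by
  have hI := Real.integral_rpow_mul_exp_neg_mul_Ioi hs hb
  have h2 := integral_comp_rpow_Ioi (fun t : ℝ => t ^ (s - 1) * Real.exp (-(b * t)))
    (p := -1) (by norm_num)
  rw [hI] at h2
  have h3 : ∫ δ in Set.Ioi (0 : ℝ), Real.exp (-b / δ) * δ ^ (-s - 1) =
      (1 / b) ^ s * Real.Gamma s := by
    rw [← h2]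
    refine setIntegral_congr_fun measurableSet_Ioi fun δ hδ => ?_
    have hδ : 0 < δ := hδ
    simp only [smul_eq_mul, abs_neg, abs_one, one_mul]
    rw [← Real.rpow_mul hδ.le, ← mul_assoc, ← Real.rpow_add hδ, Real.rpow_neg_one, mul_comm]
    congr 2 <;> ring_nf
  have hpos : 0 < (1 / b) ^ s * Real.Gamma s := by
    have := Real.Gamma_pos_of_pos hs
    positivity
  rw [← h3, ofReal_integral_eq_lintegral_ofReal]
  · exact Integrable.of_integral_ne_zero (by rw [h3]; exact hpos.ne')
  · refine (ae_restrict_iff' measurableSet_Ioi).2 (Filter.Eventually.of_forall fun δ hδ => ?_)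
    have : 0 < δ := hδ
    simp only [Pi.zero_apply]
    positivity

lemma exists_exp_neg_mul_le {u r : ℝ} (hu : 0 ≤ u) (hr : 0 < r) :
    ∃ C : ℝ, 0 ≤ C ∧ ∀ t : ℝ, 0 < t → Real.exp (-(r * t)) ≤ C * t ^ (-u) := by
  -- From `y ≤ exp y` with `y = rt/k`, raised to the power `u`; the loss `u/k` in the exponent is at
  -- most `1`. A `k > u` is also nonzero when `u = 0`.
  obtain ⟨k, hk⟩ := exists_nat_gt u
  have hk0 : (0 : ℝ) < k := hu.trans_lt hk
  refine ⟨(k / r) ^ u, by positivity, fun t ht => ?_⟩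
  have h1 : (r * t / k) ^ u ≤ Real.exp (r * t) := by
    calc (r * t / k) ^ u ≤ (Real.exp (r * t / k)) ^ u := by
          refine Real.rpow_le_rpow (by positivity) ?_ hu
          linarith [Real.add_one_le_exp (r * t / k)]
      _ = Real.exp (r * t / k * u) := by rw [← Real.exp_mul]
      _ ≤ Real.exp (r * t) := by
          apply Real.exp_le_exp.2
          rw [div_mul_eq_mul_div, div_le_iff₀ hk0]
          exact mul_le_mul_of_nonneg_left hk.le (by positivity)
  have h2 : (k / r) ^ u * t ^ (-u) = ((r * t / k) ^ u)⁻¹ := by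
    rw [Real.rpow_neg ht.le, ← Real.inv_rpow ht.le, ← Real.mul_rpow (by positivity) (by positivity),
      ← Real.inv_rpow (by positivity)]
    congr 1
    field_simp
  rw [Real.exp_neg, h2]
  exact inv_anti₀ (by positivity) h1

/-- The local singularity is `|x|^{-(n-a)}`. Trading the factor `exp(-δ/4π)` for the power
`δ^{-(s-(n-a))/2}` raises the exponent to any larger `s`, so one lemma serves both near the origin
and at infinity. -/
lemma exists_besselE_le (n : ℕ) {a s : ℝ} (ha : 0 < a) (han : a < n) (hs : n - a ≤ s) :
    ∃ C : ℝ, 0 ≤ C ∧ ∀ x : Rn n, x ≠ 0 → besselE n a x ≤ ENNReal.ofReal (C * ‖x‖ ^ (-s)) := by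
  obtain ⟨C, hC0, hC⟩ := exists_exp_neg_mul_le (u := (s - (n - a)) / 2)
    (r := 1 / (4 * Real.pi)) (by linarith) (by positivity)
  have hs0 : 0 < s := by linarith
  have hG := Real.Gamma_pos_of_pos (show 0 < a / 2 by positivity)
  have hG' := Real.Gamma_pos_of_pos (show 0 < s / 2 by positivity)
  set c := (1 / (4 * Real.pi)) ^ (a / 2) / Real.Gamma (a / 2) with hc
  have hc0 : 0 ≤ c := by positivity
  refine ⟨c * C * ((1 / Real.pi) ^ (s / 2) * Real.Gamma (s / 2)), by positivity, fun x hx => ?_⟩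
  have hx0 : 0 < ‖x‖ := norm_pos_iff.2 hx
  rw [besselE, lintegral_mixLaw a (by unfold gaussKernel; fun_prop)]
  calc ∫⁻ δ in Set.Ioi (0 : ℝ), ENNReal.ofReal (mixDensity a δ) *
        ENNReal.ofReal (gaussKernel n δ x)
      ≤ ∫⁻ δ in Set.Ioi (0 : ℝ), ENNReal.ofReal (c * C) *
        ENNReal.ofReal (Real.exp (-(Real.pi * ‖x‖ ^ 2) / δ) * δ ^ (-(s / 2) - 1)) := by
        refine setLIntegral_mono' measurableSet_Ioi fun δ hδ => ?_
        have hδ : 0 < δ := hδ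
        rw [← ENNReal.ofReal_mul (mixDensity_nonneg ha hδ), ← ENNReal.ofReal_mul (by positivity)]
        apply ENNReal.ofReal_le_ofReal
        have e : δ ^ (-(s / 2) - 1) =
            δ ^ (a / 2 - 1) * δ ^ (-(n : ℝ) / 2) * δ ^ (-((s - (n - a)) / 2)) := by
          rw [← Real.rpow_add hδ, ← Real.rpow_add hδ]
          ring_nf
        have h1 := hC δ hδ
        rw [e, mixDensity, gaussKernel, ← hc, ← neg_mul]
        calc _ = c * δ ^ (a / 2 - 1) * δ ^ (-(n : ℝ) / 2) * Real.exp (-Real.pi * ‖x‖ ^ 2 / δ) *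
              Real.exp (-(1 / (4 * Real.pi) * δ)) := by ring_nf
          _ ≤ c * δ ^ (a / 2 - 1) * δ ^ (-(n : ℝ) / 2) * Real.exp (-Real.pi * ‖x‖ ^ 2 / δ) *
              (C * δ ^ (-((s - (n - a)) / 2))) := by gcongr
          _ = _ := by ring_nf
    _ = ENNReal.ofReal (c * C * ((1 / Real.pi) ^ (s / 2) * Real.Gamma (s / 2)) * ‖x‖ ^ (-s)) := by
        rw [lintegral_const_mul' _ _ ENNReal.ofReal_ne_top,
          lintegral_exp_neg_div_mul_rpow (by positivity) (by positivity),
          ← ENNReal.ofReal_mul (by positivity)]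
        congr 1
        have : (1 / (Real.pi * ‖x‖ ^ 2)) ^ (s / 2) = (1 / Real.pi) ^ (s / 2) * ‖x‖ ^ (-s) := by
          rw [one_div, mul_inv, Real.mul_rpow (by positivity) (by positivity), one_div,
            ← Real.rpow_natCast, ← Real.rpow_neg hx0.le, ← Real.rpow_mul hx0.le]
          congr 2
          push_cast; ring
        rw [this]; ring

/-- The Laplace transform of the Gamma law; with `b = |ξ|²` it is the Fourier multiplier of `G_a`.
-/
lemma lintegral_exp_mixLaw {a : ℝ} (ha : 0 < a) {b : ℝ} (hb : 0 ≤ b) :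
    ∫⁻ δ, ENNReal.ofReal (Real.exp (-(Real.pi * δ * b))) ∂(mixLaw a) =
      ENNReal.ofReal ((1 + 4 * Real.pi ^ 2 * b) ^ (-(a / 2))) := by
  have hG := Real.Gamma_pos_of_pos (show 0 < a / 2 by positivity)
  have hr : 0 < 1 / (4 * Real.pi) + Real.pi * b := by positivity
  have hI := Real.integral_rpow_mul_exp_neg_mul_Ioi (show 0 < a / 2 by positivity) hr
  have hpos : 0 < (1 / (1 / (4 * Real.pi) + Real.pi * b)) ^ (a / 2) * Real.Gamma (a / 2) := by
    positivity
  set c := (1 / (4 * Real.pi)) ^ (a / 2) / Real.Gamma (a / 2) with hc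
  have hc0 : 0 ≤ c := by positivity
  rw [lintegral_mixLaw a (by fun_prop)]
  calc _ = ∫⁻ δ in Set.Ioi (0 : ℝ), ENNReal.ofReal c * ENNReal.ofReal
        (δ ^ (a / 2 - 1) * Real.exp (-((1 / (4 * Real.pi) + Real.pi * b) * δ))) := by
        refine setLIntegral_congr_fun measurableSet_Ioi fun δ hδ => ?_
        rw [← ENNReal.ofReal_mul (mixDensity_nonneg ha hδ), ← ENNReal.ofReal_mul (by positivity)]
        congr 1
        rw [mixDensity, ← hc, mul_assoc, ← Real.exp_add, mul_assoc]
        ring_nf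
    _ = _ := by
        rw [lintegral_const_mul' _ _ ENNReal.ofReal_ne_top, ← ofReal_integral_eq_lintegral_ofReal,
          hI, ← ENNReal.ofReal_mul hc0]
        · congr 1
          rw [hc, div_mul_eq_mul_div, mul_comm _ (Real.Gamma _), ← mul_assoc,
            mul_div_assoc, mul_comm (_ * Real.Gamma _) , Real.rpow_neg (by positivity),
            ← Real.inv_rpow (by positivity)]
          rw [mul_comm ((1 / (4 * Real.pi)) ^ (a / 2)) , ← mul_assoc, div_mul_cancel₀ _ hG.ne',
            ← Real.mul_rpow (by positivity) (by positivity)]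
          congr 1
          field_simp
        · exact Integrable.of_integral_ne_zero (by rw [hI]; exact hpos.ne')
        · refine (ae_restrict_iff' measurableSet_Ioi).2 (Filter.Eventually.of_forall fun δ hδ => ?_)
          have : 0 < δ := hδ
          simp only [Pi.zero_apply]
          positivity

/-! ### Product measures and Gaussian integrals on `ℝ^{mn}` -/

lemma lintegral_pi_prod_eq_prod {m : ℕ} {X : Type*} [MeasurableSpace X]
    {μ : Fin m → Measure X} [∀ i, SigmaFinite (μ i)]
    {f : Fin m → X → ℝ≥0∞} (hf : ∀ i, Measurable (f i)) :
    ∫⁻ x : Fin m → X, ∏ i, f i (x i) ∂(Measure.pi μ) = ∏ i, ∫⁻ x, f i x ∂(μ i) := by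
  induction m with
  | zero => simp
  | succ m ih =>
    have hmp := (measurePreserving_piFinSuccAbove μ 0).symm
    rw [← hmp.lintegral_comp (by fun_prop), Fin.prod_univ_succ, ← ih (fun i => hf i.succ),
      ← lintegral_prod_mul (hf 0).aemeasurable (Finset.measurable_prod _ fun i _ =>
        (hf i.succ).comp (measurable_pi_apply i)).aemeasurable]
    refine lintegral_congr fun x => ?_
    rw [Fin.prod_univ_succ]
    simp [MeasurableEquiv.piFinSuccAbove, Fin.insertNthEquiv]


lemma integral_exp_neg_pi_mul_sq_norm (V : Type*) [NormedAddCommGroup V] [InnerProductSpace ℝ V]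
    [FiniteDimensional ℝ V] [MeasurableSpace V] [BorelSpace V] :
    ∫ v : V, Real.exp (-Real.pi * ‖v‖ ^ 2) = 1 := by
  rw [GaussianFourier.integral_rexp_neg_mul_sq_norm Real.pi_pos, div_self Real.pi_ne_zero,
    Real.one_rpow]

/-- Both measures are translation-invariant, so they differ by a scalar. That scalar is `1` because
`exp(-π‖x‖²)` has integral `1` for each of them. -/
lemma measurePreserving_toLp (m n : ℕ) :
    MeasurePreserving (WithLp.toLp 2 : (Fin m → Rn n) → Rmn m n) := by
  have hmeas : Measurable (WithLp.toLp 2 : (Fin m → Rn n) → Rmn m n) :=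
    (PiLp.continuous_toLp 2 _).measurable
  refine ⟨hmeas, ?_⟩
  set e : (Fin m → Rn n) ≃L[ℝ] Rmn m n := (PiLp.continuousLinearEquiv 2 ℝ fun _ => Rn n).symm
  have he : (WithLp.toLp 2 : (Fin m → Rn n) → Rmn m n) = e := rfl
  have : (Measure.map (WithLp.toLp 2 : (Fin m → Rn n) → Rmn m n) volume).IsAddHaarMeasure := by
    rw [he]; exact e.isAddHaarMeasure_map _
  set ν := Measure.map (WithLp.toLp 2 : (Fin m → Rn n) → Rmn m n) volume with hν
  have h1 : ν = ν.addHaarScalarFactor volume • (volume : Measure (Rmn m n)) :=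
    Measure.isAddLeftInvariant_eq_smul ν volume
  have h2 : ∫ x : Rmn m n, Real.exp (-Real.pi * ‖x‖ ^ 2) ∂ν = 1 := by
    rw [hν, integral_map hmeas.aemeasurable (by fun_prop)]
    have : ∀ x : Fin m → Rn n, Real.exp (-Real.pi * ‖(WithLp.toLp 2 x : Rmn m n)‖ ^ 2) =
        ∏ k, Real.exp (-Real.pi * ‖x k‖ ^ 2) := fun x => by
      rw [PiLp.norm_sq_eq_of_L2, Finset.mul_sum, Real.exp_sum]
    simp_rw [this]
    rw [integral_fintype_prod_volume_eq_prod (fun _ (v : Rn n) => Real.exp (-Real.pi * ‖v‖ ^ 2))]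
    simp_rw [integral_exp_neg_pi_mul_sq_norm, Finset.prod_const_one]
  rw [h1, integral_smul_nnreal_measure, integral_exp_neg_pi_mul_sq_norm] at h2
  have h3 : ν.addHaarScalarFactor volume = 1 := by
    have : ((ν.addHaarScalarFactor volume : NNReal) : ℝ) = 1 := by
      simpa [NNReal.smul_def] using h2
    exact_mod_cast this
  rw [h1, h3, one_smul]

lemma measurableEmbedding_toLp (m n : ℕ) :
    MeasurableEmbedding (WithLp.toLp 2 : (Fin m → Rn n) → Rmn m n) :=
  (PiLp.continuousLinearEquiv 2 ℝ fun _ : Fin m => Rn n).symm.toHomeomorph.measurableEmbedding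

lemma integrable_cexp_neg_mul_sq_norm_add {V : Type*} [NormedAddCommGroup V]
    [InnerProductSpace ℝ V] [FiniteDimensional ℝ V] [MeasurableSpace V] [BorelSpace V]
    {b : ℝ} (hb : 0 < b) (c : ℂ) (w : V) :
    Integrable (fun v : V => Complex.exp (-(b : ℂ) * ‖v‖ ^ 2 + c * inner ℝ w v)) :=
  GaussianFourier.integrable_cexp_neg_mul_sq_norm_add (by simpa using hb) c w

/-- The Gaussian symbol `∏ₖ exp(-π δₖ |ξₖ|²)`. -/
def gaussSymbol {m n : ℕ} (δ : Fin m → ℝ) (ξ : Rmn m n) : ℝ :=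
  ∏ k, Real.exp (-(Real.pi * δ k * ‖ξ k‖ ^ 2))

lemma gaussSymbol_nonneg {m n : ℕ} (δ : Fin m → ℝ) (ξ : Rmn m n) : 0 ≤ gaussSymbol δ ξ :=
  Finset.prod_nonneg fun _ _ => (Real.exp_pos _).le

@[fun_prop]
lemma measurable_gaussSymbol {m n : ℕ} :
    Measurable (fun z : (Fin m → ℝ) × Rmn m n => gaussSymbol z.1 z.2) := by
  unfold gaussSymbol; fun_prop

lemma gaussSymbol_mul_cexp {m n : ℕ} (δ : Fin m → ℝ) (y : Rn n) (x : Fin m → Rn n) :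
    ((gaussSymbol δ (WithLp.toLp 2 x : Rmn m n) : ℝ) : ℂ) *
      Complex.exp (((2 * Real.pi * inner ℝ y (∑ k, x k) : ℝ) : ℂ) * Complex.I) =
    ∏ k, Complex.exp (-((Real.pi * δ k : ℝ) : ℂ) * ‖x k‖ ^ 2 +
      (2 * Real.pi * Complex.I) * (inner ℝ y (x k) : ℝ)) := by
  simp_rw [Complex.exp_add]
  rw [Finset.prod_mul_distrib, ← Complex.exp_sum, ← Complex.exp_sum, gaussSymbol,
    ← Real.exp_sum, Complex.ofReal_exp, inner_sum]
  congr 2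
  · push_cast
    simp
  · push_cast
    rw [Finset.mul_sum, Finset.sum_mul]
    exact Finset.sum_congr rfl fun k _ => by ring

lemma integral_gaussSymbol {m n : ℕ} {δ : Fin m → ℝ} (hδ : ∀ k, 0 < δ k) (y : Rn n) :
    ∫ ξ : Rmn m n, ((gaussSymbol δ ξ : ℝ) : ℂ) *
      Complex.exp (((2 * Real.pi * inner ℝ y (∑ k, ξ k) : ℝ) : ℂ) * Complex.I) =
    ((∏ k, gaussKernel n (δ k) y : ℝ) : ℂ) := by
  rw [← (measurePreserving_toLp m n).integral_comp (measurableEmbedding_toLp m n)]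
  simp only [gaussSymbol_mul_cexp]
  rw [integral_fintype_prod_volume_eq_prod (fun k (v : Rn n) =>
    Complex.exp (-((Real.pi * δ k : ℝ) : ℂ) * ‖v‖ ^ 2 +
      (2 * Real.pi * Complex.I) * (inner ℝ y v : ℝ)))]
  rw [Complex.ofReal_prod]
  refine Finset.prod_congr rfl fun k _ => ?_
  have hp : 0 < Real.pi * δ k := mul_pos Real.pi_pos (hδ k)
  rw [GaussianFourier.integral_cexp_neg_mul_sq_norm_add (by rw [Complex.ofReal_re]; exact hp)]
  have hd : (δ k : ℂ) ≠ 0 := by exact_mod_cast (hδ k).ne'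
  have hpi : (Real.pi : ℂ) ≠ 0 := by exact_mod_cast Real.pi_ne_zero
  have e1 : (Real.pi : ℂ) / ((Real.pi * δ k : ℝ) : ℂ) = (((δ k)⁻¹ : ℝ) : ℂ) := by
    push_cast; field_simp
  have e2 : ((Module.finrank ℝ (Rn n) : ℂ) / 2) = (((n : ℝ) / 2 : ℝ) : ℂ) := by
    simp
  rw [e1, e2, ← Complex.ofReal_cpow (by have := hδ k; positivity), gaussKernel,
    Complex.ofReal_mul (_ ^ _), Complex.ofReal_exp, Real.inv_rpow (hδ k).le,
    ← Real.rpow_neg (hδ k).le, neg_div]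
  congr 2
  push_cast
  field_simp
  rw [Complex.I_sq]; ring

lemma integrable_gaussSymbol {m n : ℕ} {δ : Fin m → ℝ} (hδ : ∀ k, 0 < δ k) :
    Integrable (fun ξ : Rmn m n => gaussSymbol δ ξ) := by
  have h := (measurePreserving_toLp m n).integrable_comp_emb (measurableEmbedding_toLp m n)
    (g := fun ξ : Rmn m n => ((gaussSymbol δ ξ : ℝ) : ℂ))
  have h2 : Integrable (fun ξ : Rmn m n => ((gaussSymbol δ ξ : ℝ) : ℂ)) := by
    rw [← h]
    have := Integrable.fintype_prod (𝕜 := ℂ) (ι := Fin m) (μ := fun _ => (volume : Measure (Rn n)))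
      (f := fun k v => Complex.exp (-((Real.pi * δ k : ℝ) : ℂ) * ‖v‖ ^ 2 +
      (2 * Real.pi * Complex.I) * (inner ℝ (0 : Rn n) v : ℝ)))
      (fun k => integrable_cexp_neg_mul_sq_norm_add (mul_pos Real.pi_pos (hδ k)) _ _)
    refine this.congr (Filter.Eventually.of_forall fun x => ?_)
    have e := gaussSymbol_mul_cexp δ 0 x
    simp only [inner_zero_left, mul_zero, Complex.ofReal_zero, zero_mul, Complex.exp_zero, mul_one,
      Function.comp] at e ⊢
    exact e.symm
  simpa using h2.re

/-- `ξ ↦ ∑ₖ ξₖ`. -/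
def slotSum {m n : ℕ} (ξ : Rmn m n) : Rn n := ∑ k, ξ k

@[fun_prop]
lemma continuous_slotSum {m n : ℕ} : Continuous (slotSum : Rmn m n → Rn n) := by
  unfold slotSum; fun_prop

lemma inner_diag {m n : ℕ} (x : Rn n) (ξ : Rmn m n) :
    inner ℝ ξ (diag m n x) = inner ℝ x (slotSum ξ) := by
  rw [PiLp.inner_apply, slotSum, inner_sum]
  exact Finset.sum_congr rfl fun k _ => real_inner_comm _ _

lemma continuous_fourierInv {n : ℕ} {h : Rn n → ℂ} (hh : Integrable h) :
    Continuous (𝓕⁻ h) := by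
  have := VectorFourier.fourierIntegral_continuous (e := Real.fourierChar)
    (L := -innerₗ (Rn n)) (μ := volume) Real.continuous_fourierChar
    (by simpa using! continuous_inner.neg) hh
  exact this

/-- The energy identity for a single `δ`: expand `|ȟ|²` as a double integral and integrate in `ξ`
first. The Gaussian makes the triple integral absolutely convergent, which need not hold for
`invSymbol` itself. -/
lemma integral_gaussSymbol_mul_fourierInv {m n : ℕ} {δ : Fin m → ℝ} (hδ : ∀ k, 0 < δ k)
    {h : Rn n → ℂ} (hh : Integrable h) :
    ∫ ξ : Rmn m n, ((gaussSymbol δ ξ * ‖𝓕⁻ h (slotSum ξ)‖ ^ 2 : ℝ) : ℂ) =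
      ∫ z : Rn n × Rn n, h z.1 * (starRingEnd ℂ) (h z.2) *
        ((∏ k, gaussKernel n (δ k) (z.1 - z.2) : ℝ) : ℂ) := by
  have hconj : Integrable (fun x => (starRingEnd ℂ) (h x)) := hh.norm.congr' 
    (Complex.continuous_conj.comp_aestronglyMeasurable hh.1) (by simp)
  have hprod : Integrable (fun z : Rn n × Rn n => h z.1 * (starRingEnd ℂ) (h z.2)) :=
    hh.mul_prod hconj
  have key : ∀ ξ : Rmn m n, ((gaussSymbol δ ξ * ‖𝓕⁻ h (slotSum ξ)‖ ^ 2 : ℝ) : ℂ) =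
      ∫ z : Rn n × Rn n, (h z.1 * (starRingEnd ℂ) (h z.2)) * (((gaussSymbol δ ξ : ℝ) : ℂ) *
        Complex.exp (((2 * Real.pi * inner ℝ (z.1 - z.2) (∑ k, ξ k) : ℝ) : ℂ) * Complex.I)) := by
    intro ξ
    rw [Complex.ofReal_mul, Complex.ofReal_pow, ← Complex.mul_conj', Real.fourierInv_eq',
      ← integral_conj, ← integral_prod_mul, ← integral_const_mul]
    refine integral_congr_ae (Filter.Eventually.of_forall fun z => ?_)
    simp only [smul_eq_mul, map_mul, ← Complex.exp_conj, Complex.conj_ofReal, Complex.conj_I,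
      inner_sub_left, slotSum]
    rw [show (((2 * Real.pi * (inner ℝ z.1 (∑ k, ξ k) - inner ℝ z.2 (∑ k, ξ k)) : ℝ) : ℂ) *
      Complex.I) = ((2 * Real.pi * inner ℝ z.1 (∑ k, ξ k) : ℝ) : ℂ) * Complex.I +
        ((2 * Real.pi * inner ℝ z.2 (∑ k, ξ k) : ℝ) : ℂ) * -Complex.I by push_cast; ring,
      Complex.exp_add]
    ring
  simp_rw [key]
  rw [integral_integral_swap]
  · refine integral_congr_ae (Filter.Eventually.of_forall fun z => ?_)
    dsimp only
    rw [integral_const_mul, integral_gaussSymbol hδ]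
  · have h1 : Integrable (fun w : Rmn m n × (Rn n × Rn n) =>
        ((gaussSymbol δ w.1 : ℝ) : ℂ) * (h w.2.1 * (starRingEnd ℂ) (h w.2.2)))
        (volume.prod volume) := (integrable_gaussSymbol hδ).ofReal.mul_prod hprod
    have h2 := h1.bdd_mul (c := 1) (f := fun w : Rmn m n × (Rn n × Rn n) =>
      Complex.exp (((2 * Real.pi * inner ℝ (w.2.1 - w.2.2) (∑ k, w.1 k) : ℝ) : ℂ) * Complex.I))
      (Continuous.aestronglyMeasurable (by fun_prop))
      (Filter.Eventually.of_forall fun w => (Complex.norm_exp_ofReal_mul_I _).le)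
    refine h2.congr (Filter.Eventually.of_forall fun w => ?_)
    simp only [Function.uncurry]
    ring


/-! ### The energy and the bilinear form -/

/-- The kernel `∏ₖ G_{αₖ}`, with values in `ℝ≥0∞`. -/
def kernelE {m : ℕ} (n : ℕ) (α : Fin m → ℝ) (x : Rn n) : ℝ≥0∞ := ∏ k, besselE n (α k) x

/-- The double integral `∫∫ f(x) ∏ₖ G_{αₖ}(x - w) f(w) dx dw` of an `ℝ≥0∞`-valued function. -/
def formE {m n : ℕ} (α : Fin m → ℝ) (f : Rn n → ℝ≥0∞) : ℝ≥0∞ :=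
  ∫⁻ z : Rn n × Rn n, f z.1 * kernelE n α (z.1 - z.2) * f z.2

/-- The symbol `∏ₖ (1 + 4π²|ξₖ|²)^{-αₖ/2}`. -/
def invSymbol {m n : ℕ} (α : Fin m → ℝ) (ξ : Rmn m n) : ℝ :=
  ∏ k, (1 + 4 * Real.pi ^ 2 * ‖ξ k‖ ^ 2) ^ (-(α k / 2))

/-- The energy `∫ ∏ₖ (1 + 4π²|ξₖ|²)^{-αₖ/2} |ȟ(ξ₁ + ⋯ + ξₘ)|² dξ`. -/
def energyE {m n : ℕ} (α : Fin m → ℝ) (h : Rn n → ℂ) : ℝ≥0∞ :=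
  ∫⁻ ξ : Rmn m n, ENNReal.ofReal (invSymbol α ξ * ‖𝓕⁻ h (slotSum ξ)‖ ^ 2)

lemma measurable_kernelE {m n : ℕ} {α : Fin m → ℝ} (hα : ∀ k, 0 < α k) :
    Measurable (kernelE n α) :=
  Finset.measurable_prod _ fun k _ => measurable_besselE n (hα k)

lemma kernelE_neg {m n : ℕ} (α : Fin m → ℝ) (x : Rn n) : kernelE n α (-x) = kernelE n α x := by
  simp [kernelE, besselE_neg]

lemma invSymbol_pos {m n : ℕ} (α : Fin m → ℝ) (ξ : Rmn m n) : 0 < invSymbol α ξ :=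
  Finset.prod_pos fun _ _ => by positivity

/-- The joint law of the mixing parameters. -/
def mixLawPi {m : ℕ} (α : Fin m → ℝ) : Measure (Fin m → ℝ) := Measure.pi fun k => mixLaw (α k)

lemma isProbabilityMeasure_mixLawPi {m : ℕ} {α : Fin m → ℝ} (hα : ∀ k, 0 < α k) :
    IsProbabilityMeasure (mixLawPi α) := by
  have := fun k => isProbabilityMeasure_mixLaw (hα k)
  unfold mixLawPi; infer_instance

lemma ae_pos_mixLawPi {m : ℕ} {α : Fin m → ℝ} (hα : ∀ k, 0 < α k) :
    ∀ᵐ δ ∂(mixLawPi α), ∀ k, 0 < δ k := by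
  have := fun k => isProbabilityMeasure_mixLaw (hα k)
  refine ae_all_iff.2 fun k => ?_
  exact (Measure.quasiMeasurePreserving_eval (fun k => mixLaw (α k)) k).ae (ae_pos_mixLaw (α k))

lemma kernelE_eq_lintegral {m n : ℕ} {α : Fin m → ℝ} (hα : ∀ k, 0 < α k) (x : Rn n) :
    kernelE n α x = ∫⁻ δ, ENNReal.ofReal (∏ k, gaussKernel n (δ k) x) ∂(mixLawPi α) := by
  have := fun k => isProbabilityMeasure_mixLaw (hα k)
  unfold kernelE besselE mixLawPi
  rw [← lintegral_pi_prod_eq_prod fun k => by unfold gaussKernel; fun_prop]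
  refine lintegral_congr_ae ?_
  filter_upwards [ae_pos_mixLawPi hα] with δ hδ
  rw [ENNReal.ofReal_prod_of_nonneg fun k _ => gaussKernel_nonneg n (hδ k).le x]

lemma ofReal_invSymbol_eq_lintegral {m n : ℕ} {α : Fin m → ℝ} (hα : ∀ k, 0 < α k) (ξ : Rmn m n) :
    ENNReal.ofReal (invSymbol α ξ) =
      ∫⁻ δ, ENNReal.ofReal (gaussSymbol δ ξ) ∂(mixLawPi α) := by
  have := fun k => isProbabilityMeasure_mixLaw (hα k)
  unfold invSymbol gaussSymbol mixLawPi
  simp_rw [fun δ : Fin m → ℝ => ENNReal.ofReal_prod_of_nonneg (s := Finset.univ)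
    (f := fun k => Real.exp (-(Real.pi * δ k * ‖ξ k‖ ^ 2))) fun _ _ => (Real.exp_pos _).le]
  rw [lintegral_pi_prod_eq_prod (f := fun k (t : ℝ) =>
      ENNReal.ofReal (Real.exp (-(Real.pi * t * ‖ξ k‖ ^ 2)))) fun k => by fun_prop,
    ENNReal.ofReal_prod_of_nonneg fun _ _ => by positivity]
  exact Finset.prod_congr rfl fun k _ => (lintegral_exp_mixLaw (hα k) (sq_nonneg _)).symm

/-- For almost every `δ` the inner double integral equals `∫ gaussSymbol δ |ȟ|²`, so it is a
nonnegative real and the norm loses nothing. -/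
lemma energyE_eq_lintegral {m n : ℕ} {α : Fin m → ℝ} (hα : ∀ k, 0 < α k)
    {h : Rn n → ℂ} (hh : Integrable h) :
    energyE α h = ∫⁻ δ, ‖∫ z : Rn n × Rn n, h z.1 * (starRingEnd ℂ) (h z.2) *
        ((∏ k, gaussKernel n (δ k) (z.1 - z.2) : ℝ) : ℂ)‖ₑ ∂(mixLawPi α) := by
  have := isProbabilityMeasure_mixLawPi hα
  have hc : Continuous (fun ξ : Rmn m n => 𝓕⁻ h (slotSum ξ)) :=
    (continuous_fourierInv hh).comp continuous_slotSum
  have hcm := hc.measurable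
  have e : ∀ ξ : Rmn m n, ENNReal.ofReal (invSymbol α ξ * ‖𝓕⁻ h (slotSum ξ)‖ ^ 2) =
      ∫⁻ δ, ENNReal.ofReal (gaussSymbol δ ξ * ‖𝓕⁻ h (slotSum ξ)‖ ^ 2) ∂(mixLawPi α) := by
    intro ξ
    rw [ENNReal.ofReal_mul (invSymbol_pos α ξ).le, ofReal_invSymbol_eq_lintegral hα,
      ← lintegral_mul_const' _ _ ENNReal.ofReal_ne_top]
    simp_rw [ENNReal.ofReal_mul (gaussSymbol_nonneg _ ξ)]
  unfold energyE
  simp_rw [e]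
  rw [lintegral_lintegral_swap (by
    refine Measurable.aemeasurable (Measurable.ennreal_ofReal ?_)
    refine Measurable.mul (measurable_gaussSymbol.comp measurable_swap) ?_
    exact (hcm.comp measurable_fst).norm.pow_const 2)]
  refine lintegral_congr_ae ?_
  filter_upwards [ae_pos_mixLawPi hα] with δ hδ
  have hnn : ∀ ξ : Rmn m n, 0 ≤ gaussSymbol δ ξ * ‖𝓕⁻ h (slotSum ξ)‖ ^ 2 := fun ξ =>
    mul_nonneg (gaussSymbol_nonneg δ ξ) (sq_nonneg _)
  have hint : Integrable (fun ξ : Rmn m n => gaussSymbol δ ξ * ‖𝓕⁻ h (slotSum ξ)‖ ^ 2) := by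
    refine (integrable_gaussSymbol hδ).mul_bdd (c := (∫ x, ‖h x‖) ^ 2)
      (hc.norm.pow 2).aestronglyMeasurable (Filter.Eventually.of_forall fun ξ => ?_)
    rw [norm_pow, norm_norm]
    gcongr
    rw [Real.fourierInv_eq']
    refine (norm_integral_le_integral_norm _).trans (le_of_eq ?_)
    simp only [norm_smul, Complex.norm_exp_ofReal_mul_I, one_mul]
  rw [← integral_gaussSymbol_mul_fourierInv hδ hh, integral_complex_ofReal,
    ← ofReal_integral_eq_lintegral_ofReal hint (Filter.Eventually.of_forall hnn),
    ← ofReal_norm, Complex.norm_real, Real.norm_of_nonneg (integral_nonneg hnn)]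

lemma measurable_prod_gaussKernel {m n : ℕ} :
    Measurable (fun w : (Fin m → ℝ) × (Rn n × Rn n) =>
      ∏ k, gaussKernel n (w.1 k) (w.2.1 - w.2.2)) := by
  unfold gaussKernel; fun_prop

lemma formE_eq_lintegral {m n : ℕ} {α : Fin m → ℝ} (hα : ∀ k, 0 < α k)
    {f : Rn n → ℝ≥0∞} (hf : AEMeasurable f) (hft : ∀ x, f x ≠ ∞) :
    formE α f = ∫⁻ δ, (∫⁻ z : Rn n × Rn n, f z.1 * f z.2 *
      ENNReal.ofReal (∏ k, gaussKernel n (δ k) (z.1 - z.2))) ∂(mixLawPi α) := by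
  have := isProbabilityMeasure_mixLawPi hα
  have h1 : AEMeasurable (fun z : Rn n × Rn n => f z.1 * f z.2) :=
    (hf.comp_quasiMeasurePreserving Measure.quasiMeasurePreserving_fst).mul
      (hf.comp_quasiMeasurePreserving Measure.quasiMeasurePreserving_snd)
  rw [lintegral_lintegral_swap]
  · refine lintegral_congr fun z => ?_
    rw [lintegral_const_mul' _ _ (ENNReal.mul_ne_top (hft _) (hft _)),
      ← kernelE_eq_lintegral hα]
    ring
  · refine AEMeasurable.mul ?_ measurable_prod_gaussKernel.ennreal_ofReal.aemeasurable
    exact h1.comp_quasiMeasurePreserving Measure.quasiMeasurePreserving_snd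

lemma energyE_le_formE {m n : ℕ} {α : Fin m → ℝ} (hα : ∀ k, 0 < α k)
    {h : Rn n → ℂ} (hh : Integrable h) :
    energyE α h ≤ formE α (fun x => ‖h x‖ₑ) := by
  rw [energyE_eq_lintegral hα hh, formE_eq_lintegral hα hh.1.enorm (fun _ => enorm_ne_top)]
  refine lintegral_mono_ae ?_
  filter_upwards [ae_pos_mixLawPi hα] with δ hδ
  refine (enorm_integral_le_lintegral_enorm _).trans (le_of_eq (lintegral_congr fun z => ?_))
  rw [enorm_mul, enorm_mul, RCLike.enorm_conj, ← ofReal_norm (Complex.ofReal _),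
    Complex.norm_real, Real.norm_of_nonneg
      (Finset.prod_nonneg fun k _ => gaussKernel_nonneg n (hδ k).le _)]

lemma energyE_eq_formE {m n : ℕ} {α : Fin m → ℝ} (hα : ∀ k, 0 < α k)
    {g : Rn n → ℝ} (hg : Integrable g) (hg0 : ∀ x, 0 ≤ g x) :
    energyE α (fun x => (g x : ℂ)) = formE α (fun x => ‖g x‖ₑ) := by
  have hgc : Integrable fun x => (g x : ℂ) := hg.ofReal
  rw [energyE_eq_lintegral hα hgc, formE_eq_lintegral hα hg.1.enorm (fun _ => enorm_ne_top)]
  refine lintegral_congr_ae ?_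
  filter_upwards [ae_pos_mixLawPi hα] with δ hδ
  have hnn : ∀ z : Rn n × Rn n, 0 ≤ g z.1 * g z.2 * ∏ k, gaussKernel n (δ k) (z.1 - z.2) :=
    fun z => mul_nonneg (mul_nonneg (hg0 _) (hg0 _))
      (Finset.prod_nonneg fun k _ => gaussKernel_nonneg n (hδ k).le _)
  have hmeas : Measurable (fun z : Rn n × Rn n => ∏ k, gaussKernel n (δ k) (z.1 - z.2)) :=
    measurable_prod_gaussKernel.comp (measurable_const.prodMk measurable_id)
  have hint : Integrable (fun z : Rn n × Rn n =>
      g z.1 * g z.2 * ∏ k, gaussKernel n (δ k) (z.1 - z.2)) := by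
    -- Each Gaussian factor is at most its value `δₖ^{-n/2}` at the origin.
    refine (hg.mul_prod hg).mul_bdd (c := ∏ k, (δ k) ^ (-(n : ℝ) / 2)) hmeas.aestronglyMeasurable
      (Filter.Eventually.of_forall fun z => ?_)
    rw [Real.norm_of_nonneg (Finset.prod_nonneg fun k _ => gaussKernel_nonneg n (hδ k).le _)]
    refine Finset.prod_le_prod (fun k _ => gaussKernel_nonneg n (hδ k).le _) fun k _ => ?_
    have hk := hδ k
    refine mul_le_of_le_one_right (by positivity) (Real.exp_le_one_iff.2 ?_)
    rw [neg_mul, neg_div, neg_nonpos]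
    positivity
  have e : ∀ z : Rn n × Rn n, (g z.1 : ℂ) * (starRingEnd ℂ) (g z.2 : ℂ) *
      ((∏ k, gaussKernel n (δ k) (z.1 - z.2) : ℝ) : ℂ) =
      ((g z.1 * g z.2 * ∏ k, gaussKernel n (δ k) (z.1 - z.2) : ℝ) : ℂ) := fun z => by
    rw [Complex.conj_ofReal]; push_cast; rfl
  simp_rw [e]
  rw [integral_complex_ofReal, ← ofReal_norm, Complex.norm_real,
    Real.norm_of_nonneg (integral_nonneg hnn),
    ofReal_integral_eq_lintegral_ofReal hint (Filter.Eventually.of_forall hnn)]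
  refine lintegral_congr fun z => ?_
  rw [ENNReal.ofReal_mul (mul_nonneg (hg0 _) (hg0 _)), ENNReal.ofReal_mul (hg0 _),
    Real.enorm_of_nonneg (hg0 _), Real.enorm_of_nonneg (hg0 _)]


/-! ### Power integrals over balls and their complements, by scaling to the unit ball -/

lemma lintegral_ofReal_smul {n : ℕ} {f : Rn n → ℝ≥0∞} (hf : Measurable f) {R : ℝ} (hR : 0 < R) :
    ∫⁻ x, f x = ENNReal.ofReal (R ^ (n : ℝ)) * ∫⁻ x : Rn n, f (R • x) := by
  have h := Measure.map_addHaar_smul (volume : Measure (Rn n)) hR.ne'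
  have h2 : ∫⁻ x : Rn n, f (R • x) = ENNReal.ofReal |(R ^ n)⁻¹| * ∫⁻ x, f x := by
    rw [← lintegral_map hf (measurable_const_smul R), h, lintegral_smul_measure]
    simp
  have hp : 0 < R ^ n := by positivity
  rw [h2, ← mul_assoc, ← ENNReal.ofReal_mul (by positivity), Real.rpow_natCast,
    abs_of_pos (by positivity), mul_inv_cancel₀ hp.ne', ENNReal.ofReal_one, one_mul]

lemma exists_lintegral_ball_le {n : ℕ} (hn : 1 ≤ n) {t : ℝ} (ht : t < n) :
    ∃ D : ℝ≥0∞, D ≠ ∞ ∧ ∀ R : ℝ, 0 < R →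
      ∫⁻ x in Metric.ball (0 : Rn n) R, ENNReal.ofReal (‖x‖ ^ (-t)) ≤
        D * ENNReal.ofReal (R ^ (n - t)) := by
  have : Nontrivial (Rn n) := by
    have : Nonempty (Fin n) := ⟨⟨0, hn⟩⟩
    infer_instance
  refine ⟨∫⁻ x in Metric.ball (0 : Rn n) 1, ENNReal.ofReal (‖x‖ ^ (-t)), ?_, fun R hR => ?_⟩
  · have hI : IntegrableOn (fun x : Rn n => ‖x‖ ^ (-t)) (Metric.ball 0 1) := by
      refine (integrableOn_fun_norm_addHaar (volume : Measure (Rn n))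
        (f := fun y : ℝ => y ^ (-t))).2 ?_
      have := (intervalIntegral.integrableOn_Ioo_rpow_iff (s := (n : ℝ) - 1 - t) one_pos).2
        (by linarith)
      refine this.congr_fun (fun y hy => ?_) measurableSet_Ioo
      have hy0 : 0 < y := hy.1
      rw [smul_eq_mul, finrank_euclideanSpace_fin, ← Real.rpow_natCast, ← Real.rpow_add hy0]
      rw [Nat.cast_sub hn]; push_cast; ring_nf
    exact hI.lintegral_lt_top.ne
  · rw [← lintegral_indicator measurableSet_ball, ← lintegral_indicator measurableSet_ball,
      lintegral_ofReal_smul (Measurable.indicator (by fun_prop) measurableSet_ball) hR,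
      mul_comm, ← lintegral_mul_const' _ _ ENNReal.ofReal_ne_top,
      ← lintegral_mul_const' _ _ ENNReal.ofReal_ne_top]
    refine le_of_eq (lintegral_congr fun x => ?_)
    have e : R • x ∈ Metric.ball (0 : Rn n) R ↔ x ∈ Metric.ball (0 : Rn n) 1 := by
      rw [mem_ball_zero_iff, mem_ball_zero_iff, norm_smul, Real.norm_of_nonneg hR.le,
        mul_lt_iff_lt_one_right hR]
    by_cases hx : x ∈ Metric.ball (0 : Rn n) 1
    · rw [Set.indicator_of_mem (e.2 hx), Set.indicator_of_mem hx,
        ← ENNReal.ofReal_mul (by positivity), ← ENNReal.ofReal_mul (by positivity), norm_smul,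
        Real.norm_of_nonneg hR.le, Real.mul_rpow hR.le (norm_nonneg _), sub_eq_add_neg,
        Real.rpow_add hR]
      ring_nf
    · rw [Set.indicator_of_notMem (fun h => hx (e.1 h)), Set.indicator_of_notMem hx]
      simp

lemma exists_lintegral_compl_ball_le (n : ℕ) {t : ℝ} (ht : n < t) :
    ∃ D : ℝ≥0∞, D ≠ ∞ ∧ ∀ R : ℝ, 0 < R →
      ∫⁻ x in (Metric.ball (0 : Rn n) R)ᶜ, ENNReal.ofReal (‖x‖ ^ (-t)) ≤
        D * ENNReal.ofReal (R ^ (n - t)) := by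
  have ht0 : 0 < t := (Nat.cast_nonneg n).trans_lt ht
  refine ⟨∫⁻ x in (Metric.ball (0 : Rn n) 1)ᶜ, ENNReal.ofReal (‖x‖ ^ (-t)), ?_, fun R hR => ?_⟩
  · have hI : Integrable (fun x : Rn n => 2 ^ t * (1 + ‖x‖) ^ (-t)) :=
      (integrable_one_add_norm (by simpa using ht)).const_mul _
    refine ne_top_of_le_ne_top hI.lintegral_lt_top.ne ?_
    refine (setLIntegral_mono' measurableSet_ball.compl fun x hx => ?_).trans
      (setLIntegral_le_lintegral _ _)
    have hx : 1 ≤ ‖x‖ := by simpa using hx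
    apply ENNReal.ofReal_le_ofReal
    rw [Real.rpow_neg (by positivity), Real.rpow_neg (by positivity), ← div_eq_mul_inv,
      ← Real.div_rpow (by positivity) (by positivity), ← Real.inv_rpow (by positivity)]
    refine Real.rpow_le_rpow (by positivity) ?_ ht0.le
    rw [inv_eq_one_div, div_le_div_iff₀ (by positivity) (by positivity)]
    linarith
  · rw [← lintegral_indicator measurableSet_ball.compl,
      ← lintegral_indicator measurableSet_ball.compl,
      lintegral_ofReal_smul (Measurable.indicator (by fun_prop) measurableSet_ball.compl) hR,
      mul_comm, ← lintegral_mul_const' _ _ ENNReal.ofReal_ne_top,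
      ← lintegral_mul_const' _ _ ENNReal.ofReal_ne_top]
    refine le_of_eq (lintegral_congr fun x => ?_)
    have e : R • x ∈ (Metric.ball (0 : Rn n) R)ᶜ ↔ x ∈ (Metric.ball (0 : Rn n) 1)ᶜ := by
      rw [Set.mem_compl_iff, Set.mem_compl_iff, mem_ball_zero_iff, mem_ball_zero_iff, norm_smul,
        Real.norm_of_nonneg hR.le, mul_lt_iff_lt_one_right hR]
    by_cases hx : x ∈ (Metric.ball (0 : Rn n) 1)ᶜ
    · rw [Set.indicator_of_mem (e.2 hx), Set.indicator_of_mem hx,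
        ← ENNReal.ofReal_mul (by positivity), ← ENNReal.ofReal_mul (by positivity), norm_smul,
        Real.norm_of_nonneg hR.le, Real.mul_rpow hR.le (norm_nonneg _), sub_eq_add_neg,
        Real.rpow_add hR]
      ring_nf
    · rw [Set.indicator_of_notMem (fun h => hx (e.1 h)), Set.indicator_of_notMem hx]
      simp

/-! ### A diagonal Hardy–Littlewood–Sobolev inequality -/

section HLS

variable {n : ℕ} {p q : ℝ} {K : Rn n → ℝ≥0∞} {A B : ℝ≥0∞}

/-- Split at distance `R` from `x`. Inside, `f ≤ a` and the kernel is integrable; outside, Hölder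
pairs the `L^q` tail of the kernel with `‖f‖_p = φ`. -/
lemma lintegral_kernel_mul_le (hn : 1 ≤ n) (hq : 0 < q) (hpq : q.HolderConjugate p)
    (hK : Measurable K)
    (hA : ∀ R : ℝ, 0 < R → ∫⁻ x in Metric.ball (0 : Rn n) R, K x ≤
      A * ENNReal.ofReal (R ^ (n - 2 * n / q)))
    (hB : ∀ R : ℝ, 0 < R → (∫⁻ x in (Metric.ball (0 : Rn n) R)ᶜ, K x ^ q) ^ (1 / q) ≤
      B * ENNReal.ofReal (R ^ (-(n / q))))
    {f : Rn n → ℝ≥0∞} (hf : Measurable f) {a φ : ℝ} (ha : 0 < a) (hφ : 0 < φ)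
    (hF : (∫⁻ x, f x ^ p) ^ (1 / p) = ENNReal.ofReal φ) (x : Rn n) :
    ∫⁻ w in {w | f w ≤ ENNReal.ofReal a}, K (x - w) * f w ≤
      (A + B) * ENNReal.ofReal (φ ^ (2 - p) * a ^ (p - 1)) := by
  have hn0 : (0 : ℝ) < n := by exact_mod_cast hn
  have hpq' : p / q = p - 1 := by
    have := hpq.symm.sub_one_mul_conj
    rw [div_eq_iff hq.ne']; linarith
  set S := {w | f w ≤ ENNReal.ofReal a} with hS
  have hSm : MeasurableSet S := measurableSet_le hf measurable_const
  -- This radius balances the two parts: `R^{n-2n/q} a` and `R^{-n/q} φ` both equal `φ^{2-p}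
  -- a^{p-1}`, since `p/q = p - 1`.
  set R := (φ / a) ^ (p / n) with hR
  have hda : 0 < φ / a := by positivity
  have hR0 : 0 < R := by positivity
  have hKx : Measurable fun w => K (x - w) := hK.comp (measurable_const.sub measurable_id)
  have trans : ∀ (g : Rn n → ℝ≥0∞) (T : Set (Rn n)), MeasurableSet T →
      ∫⁻ w in {w | x - w ∈ T}, g (x - w) = ∫⁻ w in T, g w := by
    intro g T hT
    have hT' : MeasurableSet {w | x - w ∈ T} :=
      (measurable_const.sub measurable_id) hT
    rw [← lintegral_indicator hT, ← lintegral_indicator hT',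
      ← lintegral_sub_left_eq_self (T.indicator g) x]
    rfl
  set U := {w | x - w ∈ Metric.ball (0 : Rn n) R} with hU
  have hUm : MeasurableSet U := (measurable_const.sub measurable_id) measurableSet_ball
  have hUc : Uᶜ = {w | x - w ∈ (Metric.ball (0 : Rn n) R)ᶜ} := rfl
  have near : ∫⁻ w in S ∩ U, K (x - w) * f w ≤ A * ENNReal.ofReal (φ ^ (2 - p) * a ^ (p - 1)) := by
    calc _ ≤ ∫⁻ w in S ∩ U, K (x - w) * ENNReal.ofReal a :=
          setLIntegral_mono' (hSm.inter hUm) fun w hw => mul_le_mul_right (hw.1) _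
      _ ≤ ∫⁻ w in U, K (x - w) * ENNReal.ofReal a :=
          lintegral_mono_set Set.inter_subset_right
      _ = (∫⁻ w in Metric.ball (0 : Rn n) R, K w) * ENNReal.ofReal a := by
          rw [lintegral_mul_const' _ _ ENNReal.ofReal_ne_top, trans K _ measurableSet_ball]
      _ ≤ A * ENNReal.ofReal (R ^ (n - 2 * n / q)) * ENNReal.ofReal a := by
          gcongr; exact hA R hR0
      _ = _ := by
          rw [mul_assoc, ← ENNReal.ofReal_mul (by positivity)]
          congr 2
          rw [hR, ← Real.rpow_mul hda.le,
            show p / n * (n - 2 * n / q) = 2 - p by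
              rw [show p / n * (n - 2 * n / q) = p - 2 * (p / q) by field_simp, hpq']; ring,
            Real.div_rpow hφ.le ha.le, div_mul_eq_mul_div, mul_div_assoc]
          congr 1
          rw [div_eq_iff (by positivity), ← Real.rpow_add ha,
            show p - 1 + (2 - p) = 1 by ring, Real.rpow_one]
  have far : ∫⁻ w in Uᶜ, K (x - w) * f w ≤ B * ENNReal.ofReal (φ ^ (2 - p) * a ^ (p - 1)) := by
    calc _ ≤ (∫⁻ w in Uᶜ, K (x - w) ^ q) ^ (1 / q) * (∫⁻ w in Uᶜ, f w ^ p) ^ (1 / p) :=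
          ENNReal.lintegral_mul_le_Lp_mul_Lq _ hpq hKx.aemeasurable hf.aemeasurable
      _ ≤ (B * ENNReal.ofReal (R ^ (-(n / q)))) * ENNReal.ofReal φ := by
          rw [hUc, trans (fun y => K y ^ q) _ measurableSet_ball.compl, ← hF]
          have := hpq.symm.pos
          gcongr
          · exact hB R hR0
          · exact Measure.restrict_le_self
      _ = _ := by
          rw [mul_assoc, ← ENNReal.ofReal_mul (by positivity)]
          congr 2
          rw [hR, ← Real.rpow_mul hda.le,
            show p / n * (-(n / q)) = 1 - p by
              rw [show p / n * (-(n / q)) = - (p / q) by field_simp, hpq']; ring,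
            Real.div_rpow hφ.le ha.le, div_mul_eq_mul_div]
          nth_rewrite 2 [← Real.rpow_one φ]
          rw [← Real.rpow_add hφ, div_eq_iff (by positivity), mul_assoc, ← Real.rpow_add ha]
          ring_nf
          simp
  calc _ ≤ ∫⁻ w in (S ∩ U) ∪ Uᶜ, K (x - w) * f w := lintegral_mono_set fun w hw => by
        by_cases h : w ∈ U
        · exact Or.inl ⟨hw, h⟩
        · exact Or.inr h
    _ ≤ _ := lintegral_union_le _ _ _
    _ ≤ _ := by rw [add_mul]; exact add_le_add near far

/-- The Hardy–Littlewood–Sobolev inequality on the diagonal, for a kernel of weak type. -/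
theorem lintegral_kernel_form_le (hn : 1 ≤ n) (hq : 0 < q) (hpq : q.HolderConjugate p)
    (hK : Measurable K) (hKn : ∀ x, K (-x) = K x)
    (hA : ∀ R : ℝ, 0 < R → ∫⁻ x in Metric.ball (0 : Rn n) R, K x ≤
      A * ENNReal.ofReal (R ^ (n - 2 * n / q)))
    (hB : ∀ R : ℝ, 0 < R → (∫⁻ x in (Metric.ball (0 : Rn n) R)ᶜ, K x ^ q) ^ (1 / q) ≤
      B * ENNReal.ofReal (R ^ (-(n / q))))
    {f : Rn n → ℝ≥0∞} (hf : Measurable f) (hft : ∀ x, f x ≠ ∞) (hfp : ∫⁻ x, f x ^ p ≠ ∞) :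
    ∫⁻ z : Rn n × Rn n, f z.1 * K (z.1 - z.2) * f z.2 ≤
      2 * (A + B) * ((∫⁻ x, f x ^ p) ^ (1 / p)) ^ 2 := by
  have hp0 : 0 < p := hpq.symm.pos
  set F := (∫⁻ x, f x ^ p) ^ (1 / p) with hF
  have hFt : F ≠ ∞ := ENNReal.rpow_ne_top_of_nonneg (by positivity) hfp
  have hm : Measurable (fun z : Rn n × Rn n => f z.1 * K (z.1 - z.2) * f z.2) := by fun_prop
  rcases eq_or_ne F 0 with h0 | h0
  · have h1 : ∫⁻ x, f x ^ p = 0 := by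
      rw [hF, ENNReal.rpow_eq_zero_iff_of_pos (by positivity)] at h0
      exact h0
    rw [lintegral_eq_zero_iff (by fun_prop)] at h1
    have h2 : ∀ᵐ x : Rn n, f x = 0 := by
      filter_upwards [h1] with x hx
      exact (ENNReal.rpow_eq_zero_iff_of_pos hp0).1 hx
    have : ∫⁻ z : Rn n × Rn n, f z.1 * K (z.1 - z.2) * f z.2 = 0 := by
      rw [lintegral_eq_zero_iff hm]
      filter_upwards [Measure.quasiMeasurePreserving_fst.ae h2] with z hz
      simp [hz]
    rw [this]; exact zero_le
  have hφ : 0 < F.toReal := ENNReal.toReal_pos h0 hFt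
  have hφF : F = ENNReal.ofReal F.toReal := (ENNReal.ofReal_toReal hFt).symm
  -- The kernel is even, so the region `f w ≤ f x` carries at least half of the form. There the
  -- previous lemma applies with `a = f x`, giving `F^{2-p} f(x)^p`, whose integral is `F²`; no
  -- interpolation is needed.
  set J : ℝ≥0∞ := ∫⁻ x, ∫⁻ w, {w | f w ≤ f x}.indicator (fun w => f x * K (x - w) * f w) w with hJ
  have hJle : J ≤ (A + B) * F ^ 2 := by
    have inner : ∀ x, ∫⁻ w, {w | f w ≤ f x}.indicator (fun w => f x * K (x - w) * f w) w ≤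
        (A + B) * ENNReal.ofReal (F.toReal ^ (2 - p)) * f x ^ p := by
      intro x
      rw [lintegral_indicator (measurableSet_le hf measurable_const)]
      rcases eq_or_ne (f x) 0 with hx | hx
      · simp [hx]
      have ha : 0 < (f x).toReal := ENNReal.toReal_pos hx (hft x)
      have hax : f x = ENNReal.ofReal (f x).toReal := (ENNReal.ofReal_toReal (hft x)).symm
      simp_rw [mul_assoc (f x)]
      rw [lintegral_const_mul' _ _ (hft x)]
      have := lintegral_kernel_mul_le hn hq hpq hK hA hB hf ha hφ (hF.symm.trans hφF) x
      rw [← hax] at this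
      refine (mul_le_mul_right this _).trans (le_of_eq ?_)
      rw [ENNReal.ofReal_mul (by positivity), ← ENNReal.ofReal_rpow_of_pos ha, ← hax]
      rw [show f x ^ p = f x ^ (p - 1) * f x by
        nth_rewrite 3 [← ENNReal.rpow_one (f x)]
        rw [← ENNReal.rpow_add _ _ hx (hft x)]; ring_nf]
      ring
    calc J ≤ ∫⁻ x, (A + B) * ENNReal.ofReal (F.toReal ^ (2 - p)) * f x ^ p := lintegral_mono inner
      _ = (A + B) * ENNReal.ofReal (F.toReal ^ (2 - p)) * ∫⁻ x, f x ^ p :=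
          lintegral_const_mul _ (by fun_prop)
      _ = _ := by
          have h3 : ∫⁻ x, f x ^ p = F ^ p := by
            rw [hF, ← ENNReal.rpow_mul, one_div, inv_mul_cancel₀ hp0.ne', ENNReal.rpow_one]
          rw [h3, mul_assoc, ← ENNReal.ofReal_rpow_of_pos hφ, ← hφF, ← ENNReal.rpow_add _ _ h0 hFt,
            ← ENNReal.rpow_two]
          ring_nf
  have hset : MeasurableSet {z : Rn n × Rn n | f z.2 ≤ f z.1} :=
    measurableSet_le (hf.comp measurable_snd) (hf.comp measurable_fst)
  have hset' : MeasurableSet {z : Rn n × Rn n | f z.1 ≤ f z.2} :=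
    measurableSet_le (hf.comp measurable_fst) (hf.comp measurable_snd)
  have hJ1 : ∫⁻ z in {z : Rn n × Rn n | f z.2 ≤ f z.1}, f z.1 * K (z.1 - z.2) * f z.2 = J := by
    rw [← lintegral_indicator hset, Measure.volume_eq_prod,
      lintegral_prod _ (hm.indicator hset).aemeasurable]
    rfl
  have hJ2 : ∫⁻ z in {z : Rn n × Rn n | f z.1 ≤ f z.2}, f z.1 * K (z.1 - z.2) * f z.2 = J := by
    rw [← lintegral_indicator hset', Measure.volume_eq_prod,
      lintegral_prod_symm _ (hm.indicator hset').aemeasurable]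
    refine lintegral_congr fun x => lintegral_congr fun w => ?_
    simp only [Set.indicator, Set.mem_ofPred_eq]
    rw [← hKn (w - x), neg_sub]
    split_ifs <;> ring
  calc _ ≤ ∫⁻ z in {z : Rn n × Rn n | f z.2 ≤ f z.1} ∪ {z : Rn n × Rn n | f z.1 ≤ f z.2},
        f z.1 * K (z.1 - z.2) * f z.2 := by
        rw [show {z : Rn n × Rn n | f z.2 ≤ f z.1} ∪ {z : Rn n × Rn n | f z.1 ≤ f z.2} = Set.univ
          from Set.eq_univ_of_forall fun z => le_total (f z.2) (f z.1), Measure.restrict_univ]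
    _ ≤ J + J := by
        refine (lintegral_union_le _ _ _).trans (le_of_eq ?_)
        rw [hJ1, hJ2]
    _ ≤ _ := by rw [← two_mul, mul_assoc]; gcongr

end HLS

/-! ### Size of the product kernel and boundedness of the form -/

section Kernel

variable {m n : ℕ} {α : Fin m → ℝ}

lemma exists_kernelE_le (hm : 1 ≤ m) (hα : ∀ k, 0 < α k ∧ α k < n) {s : ℝ}
    (hs : (m : ℝ) * n - ∑ k, α k ≤ s) :
    ∃ C : ℝ, 0 ≤ C ∧ ∀ x : Rn n, x ≠ 0 → kernelE n α x ≤ ENNReal.ofReal (C * ‖x‖ ^ (-s)) := by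
  have hm0 : (0 : ℝ) < m := by exact_mod_cast hm
  -- The excess of `s` over the critical exponent `mn - α` is shared equally among the `m` factors.
  set t := (s - ((m : ℝ) * n - ∑ k, α k)) / m with ht
  have ht0 : 0 ≤ t := div_nonneg (by linarith) hm0.le
  have h := fun k => exists_besselE_le n (hα k).1 (hα k).2 (s := n - α k + t) (by linarith)
  choose C hC0 hC using h
  refine ⟨∏ k, C k, Finset.prod_nonneg fun k _ => hC0 k, fun x hx => ?_⟩
  have hx0 : 0 < ‖x‖ := norm_pos_iff.2 hx
  calc kernelE n α x ≤ ∏ k, ENNReal.ofReal (C k * ‖x‖ ^ (-(n - α k + t))) :=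
        Finset.prod_le_prod' fun k _ => hC k x hx
    _ = ENNReal.ofReal (∏ k, (C k * ‖x‖ ^ (-(n - α k + t)))) :=
        (ENNReal.ofReal_prod_of_nonneg fun k _ => mul_nonneg (hC0 k) (by positivity)).symm
    _ = _ := by
        rw [Finset.prod_mul_distrib, ← Real.rpow_sum_of_pos hx0]
        congr 3
        rw [Finset.sum_neg_distrib, Finset.sum_add_distrib, Finset.sum_sub_distrib]
        simp only [Finset.sum_const, Finset.card_univ, Fintype.card_fin, nsmul_eq_mul]
        rw [ht]; field_simp; ring

lemma kernelE_ne_top (hm : 1 ≤ m) (hα : ∀ k, 0 < α k ∧ α k < n) {x : Rn n} (hx : x ≠ 0) :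
    kernelE n α x ≠ ∞ := by
  obtain ⟨C, -, hC⟩ := exists_kernelE_le hm hα le_rfl
  exact ne_top_of_le_ne_top ENNReal.ofReal_ne_top (hC x hx)

lemma ofReal_prod_besselG (hα : ∀ k, 0 < α k) {x : Rn n} (hx : kernelE n α x ≠ ∞) :
    ENNReal.ofReal (∏ k, besselG n (α k) x) = kernelE n α x := by
  simp_rw [besselG_eq_toReal n (hα _) x]
  rw [← ENNReal.toReal_prod]
  exact ENNReal.ofReal_toReal hx

lemma ae_ne_zero (hn : 1 ≤ n) : ∀ᵐ x : Rn n, x ≠ 0 := by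
  have : Nontrivial (Rn n) := by
    have : Nonempty (Fin n) := ⟨⟨0, hn⟩⟩
    infer_instance
  simp [ae_iff]

theorem exists_formE_le (hm : 1 ≤ m) (hn : 1 ≤ n) (hα : ∀ k, 0 < α k ∧ α k < n)
    (hsum : (m : ℝ) * n - ∑ k, α k < n) {p q : ℝ} (hpq : q.HolderConjugate p)
    (hq : 2 ≤ q) (hq' : (m : ℝ) * n - ∑ k, α k ≤ 2 * n / q) :
    ∃ C : ℝ≥0∞, C ≠ ∞ ∧ ∀ f : Rn n → ℝ≥0∞, Measurable f → (∀ x, f x ≠ ∞) →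
      ∫⁻ x, f x ^ p ≠ ∞ → formE α f ≤ C * ((∫⁻ x, f x ^ p) ^ (1 / p)) ^ 2 := by
  have hn0 : (0 : ℝ) < n := by exact_mod_cast hn
  have hq0 : 0 < q := by linarith
  have hae := ae_ne_zero hn
  have onball : ∀ {s : ℝ}, (m : ℝ) * n - ∑ k, α k ≤ s → s < n → ∃ D : ℝ≥0∞, D ≠ ∞ ∧
      ∀ R : ℝ, 0 < R → ∫⁻ x in Metric.ball (0 : Rn n) R, kernelE n α x ≤
        D * ENNReal.ofReal (R ^ (n - s)) := by
    intro s hs hsn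
    obtain ⟨C, hC0, hC⟩ := exists_kernelE_le hm hα hs
    obtain ⟨D, hD, hDR⟩ := exists_lintegral_ball_le hn hsn
    refine ⟨ENNReal.ofReal C * D, ENNReal.mul_ne_top ENNReal.ofReal_ne_top hD, fun R hR => ?_⟩
    calc _ ≤ ∫⁻ x in Metric.ball (0 : Rn n) R, ENNReal.ofReal C * ENNReal.ofReal (‖x‖ ^ (-s)) := by
          refine lintegral_mono_ae (ae_restrict_of_ae ?_)
          filter_upwards [hae] with x hx
          rw [← ENNReal.ofReal_mul hC0]
          exact hC x hx
      _ ≤ _ := by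
          rw [lintegral_const_mul' _ _ ENNReal.ofReal_ne_top, mul_assoc]
          gcongr
          exact hDR R hR
  have offball : ∀ {s r : ℝ}, (m : ℝ) * n - ∑ k, α k ≤ s → 0 < r → n < s * r → ∃ D : ℝ≥0∞, D ≠ ∞ ∧
      ∀ R : ℝ, 0 < R → ∫⁻ x in (Metric.ball (0 : Rn n) R)ᶜ, kernelE n α x ^ r ≤
        D * ENNReal.ofReal (R ^ (n - s * r)) := by
    intro s r hs hr hsn
    obtain ⟨C, hC0, hC⟩ := exists_kernelE_le hm hα hs
    obtain ⟨D, hD, hDR⟩ := exists_lintegral_compl_ball_le n hsn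
    refine ⟨ENNReal.ofReal (C ^ r) * D, ENNReal.mul_ne_top ENNReal.ofReal_ne_top hD,
      fun R hR => ?_⟩
    calc _ ≤ ∫⁻ x in (Metric.ball (0 : Rn n) R)ᶜ,
          ENNReal.ofReal (C ^ r) * ENNReal.ofReal (‖x‖ ^ (-(s * r))) := by
          refine lintegral_mono_ae (ae_restrict_of_ae ?_)
          filter_upwards [hae] with x hx
          rw [← ENNReal.ofReal_mul (by positivity)]
          refine (ENNReal.rpow_le_rpow (hC x hx) hr.le).trans (le_of_eq ?_)
          rw [ENNReal.ofReal_rpow_of_nonneg (by positivity) hr.le,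
            Real.mul_rpow hC0 (by positivity), ← Real.rpow_mul (norm_nonneg _), neg_mul]
      _ ≤ _ := by
          rw [lintegral_const_mul' _ _ ENNReal.ofReal_ne_top, mul_assoc]
          gcongr
          exact hDR R hR
  have hA : ∃ A : ℝ≥0∞, A ≠ ∞ ∧ ∀ R : ℝ, 0 < R →
      ∫⁻ x in Metric.ball (0 : Rn n) R, kernelE n α x ≤
        A * ENNReal.ofReal (R ^ (n - 2 * n / q)) := by
    rcases hq.eq_or_lt with h2 | h2
    -- At `q = 2` the exponent `n - 2n/q` vanishes and the bound asks for a globally integrable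
    -- kernel. The power `|x|^{-n}` is not integrable, so `mn - α < n` is used inside the unit ball
    -- and `n + 1` outside.
    · obtain ⟨D₁, hD₁, h₁⟩ := onball le_rfl hsum
      obtain ⟨D₂, hD₂, h₂⟩ := offball (s := n + 1) (r := 1) (by linarith) one_pos (by linarith)
      refine ⟨D₁ + D₂, ENNReal.add_ne_top.2 ⟨hD₁, hD₂⟩, fun R hR => ?_⟩
      have e : (n : ℝ) - 2 * n / q = 0 := by rw [← h2]; ring
      rw [e, Real.rpow_zero, ENNReal.ofReal_one, mul_one]
      have a₁ := h₁ 1 one_pos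
      have a₂ := h₂ 1 one_pos
      simp only [Real.one_rpow, ENNReal.ofReal_one, mul_one, ENNReal.rpow_one] at a₁ a₂
      refine (setLIntegral_le_lintegral _ _).trans ?_
      rw [← lintegral_add_compl _ (measurableSet_ball (x := (0 : Rn n)) (ε := 1))]
      exact add_le_add a₁ a₂
    · refine onball hq' ?_
      rw [div_lt_iff₀ hq0]
      nlinarith
  obtain ⟨A, hAt, hA⟩ := hA
  obtain ⟨D, hD, hB⟩ := offball (s := 2 * n / q) (r := q) hq' hq0
    (by rw [div_mul_cancel₀ _ hq0.ne']; linarith)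
  have hB' : ∀ R : ℝ, 0 < R → (∫⁻ x in (Metric.ball (0 : Rn n) R)ᶜ, kernelE n α x ^ q) ^ (1 / q) ≤
      D ^ (1 / q) * ENNReal.ofReal (R ^ (-(n / q))) := by
    intro R hR
    refine (ENNReal.rpow_le_rpow (hB R hR) (by positivity)).trans (le_of_eq ?_)
    rw [ENNReal.mul_rpow_of_nonneg _ _ (by positivity),
      ENNReal.ofReal_rpow_of_pos (by positivity), ← Real.rpow_mul hR.le]
    congr 3
    field_simp; ring
  refine ⟨2 * (A + D ^ (1 / q)), ENNReal.mul_ne_top (by simp) (ENNReal.add_ne_top.2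
    ⟨hAt, ENNReal.rpow_ne_top_of_nonneg (by positivity) hD⟩), fun f hf hft hfp => ?_⟩
  exact lintegral_kernel_form_le hn hq0 hpq (measurable_kernelE fun k => (hα k).1)
    (kernelE_neg α) hA hB' hf hft hfp

end Kernel


/-! ### The diagonal trace on the Fourier side -/

variable {m n : ℕ} {α : Fin m → ℝ}

lemma hasTemperateGrowth_prod {E ι : Type*} [NormedAddCommGroup E] [NormedSpace ℝ E]
    (s : Finset ι) {f : ι → E → ℝ} (hf : ∀ i, (f i).HasTemperateGrowth) :
    (fun x => ∏ i ∈ s, f i x).HasTemperateGrowth := by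
  classical
  induction s using Finset.induction_on with
  | empty => simp
  | insert i s hi ih =>
    simp_rw [Finset.prod_insert hi]
    exact (hf i).mul ih

lemma hasTemperateGrowth_prod_one_add_norm_sq (r : Fin m → ℝ) :
    (fun ξ : Rmn m n => ∏ k, (1 + 4 * Real.pi ^ 2 * ‖ξ k‖ ^ 2) ^ r k).HasTemperateGrowth := by
  refine hasTemperateGrowth_prod _ fun k => ?_
  set L : Rmn m n →L[ℝ] Rn n := (2 * Real.pi) • PiLp.proj 2 (fun _ => Rn n) k with hL
  have h := (Function.hasTemperateGrowth_one_add_norm_sq_rpow (Rn n) (r k)).comp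
    L.hasTemperateGrowth
  refine (congrArg Function.HasTemperateGrowth (funext fun ξ => ?_)).mp h
  have e : ‖L ξ‖ ^ 2 = 4 * Real.pi ^ 2 * ‖ξ k‖ ^ 2 := by
    change ‖(2 * Real.pi) • ξ k‖ ^ 2 = _
    rw [norm_smul, Real.norm_of_nonneg (by positivity)]
    ring
  rw [Function.comp, e]

lemma hasTemperateGrowth_besselSymbol (α : Fin m → ℝ) :
    (fun ξ : Rmn m n => (besselSymbol α ξ : ℂ)).HasTemperateGrowth :=
  Function.Complex.hasTemperateGrowth_ofReal.comp
    (hasTemperateGrowth_prod_one_add_norm_sq fun k => α k / 4)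

lemma contDiff_invSymbol (α : Fin m → ℝ) :
    ContDiff ℝ (⊤ : ℕ∞) (invSymbol α : Rmn m n → ℝ) :=
  (hasTemperateGrowth_prod_one_add_norm_sq fun k => -(α k / 2)).1

lemma besselSymbol_pos (α : Fin m → ℝ) (ξ : Rmn m n) : 0 < besselSymbol α ξ :=
  Finset.prod_pos fun _ _ => by positivity

lemma besselSymbol_sq_mul_invSymbol (α : Fin m → ℝ) (ξ : Rmn m n) :
    besselSymbol α ξ ^ 2 * invSymbol α ξ = 1 := by
  rw [besselSymbol, invSymbol, ← Finset.prod_pow, ← Finset.prod_mul_distrib]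
  refine Finset.prod_eq_one fun k _ => ?_
  have h : 0 < 1 + 4 * Real.pi ^ 2 * ‖ξ k‖ ^ 2 := by positivity
  rw [← Real.rpow_natCast, ← Real.rpow_mul h.le, ← Real.rpow_add h]
  convert Real.rpow_zero _ using 2
  push_cast; ring

/-- `∏ₖ (1 + 4π²|ξₖ|²)^{αₖ/4} f̂` as a Schwartz function. -/
def symbolMul (α : Fin m → ℝ) (f : 𝓢(Rmn m n, ℂ)) : 𝓢(Rmn m n, ℂ) :=
  SchwartzMap.smulLeftCLM ℂ (fun ξ : Rmn m n => (besselSymbol α ξ : ℂ)) (𝓕 f)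

lemma symbolMul_apply (α : Fin m → ℝ) (f : 𝓢(Rmn m n, ℂ)) (ξ : Rmn m n) :
    symbolMul α f ξ = (besselSymbol α ξ : ℂ) * 𝓕 (f : Rmn m n → ℂ) ξ := by
  rw [symbolMul, SchwartzMap.smulLeftCLM_apply_apply (hasTemperateGrowth_besselSymbol α),
    smul_eq_mul, SchwartzMap.fourier_coe]

/-- Plancherel, legitimate because the symbol has temperate growth and so keeps `f̂` in the Schwartz
class. -/
lemma lambdaStar_eq (α : Fin m → ℝ) (f : 𝓢(Rmn m n, ℂ)) :
    lambdaStar α f = ∫ ξ : Rmn m n, besselSymbol α ξ ^ 2 * ‖𝓕 (f : Rmn m n → ℂ) ξ‖ ^ 2 := by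
  have h1 : besselOp α f = (𝓕⁻ (symbolMul α f) : 𝓢(Rmn m n, ℂ)) := by
    rw [SchwartzMap.fourierInv_coe, besselOp]
    congr 1
    ext ξ
    rw [symbolMul_apply]
  rw [lambdaStar, h1, ← SchwartzMap.integral_norm_sq_fourier,
    FourierTransform.fourier_fourierInv_eq]
  refine integral_congr_ae (Filter.Eventually.of_forall fun ξ => ?_)
  dsimp only
  rw [symbolMul_apply, norm_mul, Complex.norm_real, Real.norm_of_nonneg (besselSymbol_pos α ξ).le,
    mul_pow]

lemma lambdaStar_nonneg (α : Fin m → ℝ) (f : 𝓢(Rmn m n, ℂ)) : 0 ≤ lambdaStar α f :=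
  integral_nonneg fun _ => by positivity

lemma integrable_symbol_sq (α : Fin m → ℝ) (f : 𝓢(Rmn m n, ℂ)) :
    Integrable fun ξ : Rmn m n => besselSymbol α ξ ^ 2 * ‖𝓕 (f : Rmn m n → ℂ) ξ‖ ^ 2 := by
  have h := ((symbolMul α f).memLp 2).integrable_norm_pow (p := 2) (by simp)
  refine h.congr (Filter.Eventually.of_forall fun ξ => ?_)
  dsimp only
  rw [symbolMul_apply, norm_mul, Complex.norm_real, Real.norm_of_nonneg (besselSymbol_pos α ξ).le,
    mul_pow]

lemma schwartz_diag_apply (f : 𝓢(Rmn m n, ℂ)) (x : Rn n) :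
    f (diag m n x) = ∫ ξ : Rmn m n,
      Complex.exp (((2 * Real.pi * inner ℝ x (slotSum ξ) : ℝ) : ℂ) * Complex.I) *
        𝓕 (f : Rmn m n → ℂ) ξ := by
  conv_lhs => rw [← FourierTransform.fourierInv_fourier_eq (F := 𝓢(Rmn m n, ℂ)) f]
  rw [SchwartzMap.fourierInv_coe, Real.fourierInv_eq', SchwartzMap.fourier_coe]
  simp_rw [inner_diag, smul_eq_mul]

/-- Identifies the transpose of the trace: restricting to the diagonal dualizes to composing `ȟ`
with `slotSum`. -/
lemma integral_diag_mul (f : 𝓢(Rmn m n, ℂ)) {h : Rn n → ℂ} (hh : Integrable h) :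
    ∫ x, f (diag m n x) * h x =
      ∫ ξ : Rmn m n, 𝓕 (f : Rmn m n → ℂ) ξ * 𝓕⁻ h (slotSum ξ) := by
  have hf : Integrable (𝓕 (f : Rmn m n → ℂ)) := by
    rw [← SchwartzMap.fourier_coe]; exact (𝓕 f).integrable
  simp_rw [schwartz_diag_apply, ← integral_mul_const]
  rw [integral_integral_swap]
  · refine integral_congr_ae (Filter.Eventually.of_forall fun ξ => ?_)
    dsimp only
    rw [Real.fourierInv_eq', ← integral_const_mul]
    refine integral_congr_ae (Filter.Eventually.of_forall fun x => ?_)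
    simp only [smul_eq_mul]
    ring
  · have h1 := (hh.mul_prod hf).bdd_mul (c := 1) (f := fun w : Rn n × Rmn m n =>
      Complex.exp (((2 * Real.pi * inner ℝ w.1 (slotSum w.2) : ℝ) : ℂ) * Complex.I))
      (Continuous.aestronglyMeasurable (by fun_prop))
      (Filter.Eventually.of_forall fun w => (Complex.norm_exp_ofReal_mul_I _).le)
    refine h1.congr (Filter.Eventually.of_forall fun w => ?_)
    simp only [Function.uncurry]
    ring

lemma enorm_integral_diag_mul_sq_le (f : 𝓢(Rmn m n, ℂ)) {h : Rn n → ℂ} (hh : Integrable h) :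
    ‖∫ x, f (diag m n x) * h x‖ₑ ^ 2 ≤ ENNReal.ofReal (lambdaStar α f) * energyE α h := by
  rw [integral_diag_mul f hh]
  set u : Rmn m n → ℂ := 𝓕 (f : Rmn m n → ℂ) with hu
  have huc : Continuous u := by rw [hu, ← SchwartzMap.fourier_coe]; exact (𝓕 f).continuous
  have hHc : Continuous (fun ξ : Rmn m n => 𝓕⁻ h (slotSum ξ)) :=
    (continuous_fourierInv hh).comp continuous_slotSum
  have hσ : Continuous (besselSymbol α : Rmn m n → ℝ) :=
    (hasTemperateGrowth_prod_one_add_norm_sq fun k => α k / 4).1.continuous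
  set a : Rmn m n → ℝ≥0∞ := fun ξ => ENNReal.ofReal (besselSymbol α ξ * ‖u ξ‖)
  set b : Rmn m n → ℝ≥0∞ := fun ξ =>
    ENNReal.ofReal ((besselSymbol α ξ)⁻¹ * ‖𝓕⁻ h (slotSum ξ)‖)
  have ham : Measurable a := (hσ.mul huc.norm).measurable.ennreal_ofReal
  have hbm : Measurable b := (hσ.measurable.inv.mul hHc.norm.measurable).ennreal_ofReal
  have ha : ∫⁻ ξ, a ξ ^ (2 : ℝ) = ENNReal.ofReal (lambdaStar α f) := by
    rw [lambdaStar_eq, ofReal_integral_eq_lintegral_ofReal (integrable_symbol_sq α f)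
      (Filter.Eventually.of_forall fun ξ => by positivity)]
    refine lintegral_congr fun ξ => ?_
    rw [ENNReal.rpow_two, ← ENNReal.ofReal_pow
      (mul_nonneg (besselSymbol_pos α ξ).le (norm_nonneg _)), mul_pow]
  have hb : ∫⁻ ξ, b ξ ^ (2 : ℝ) = energyE α h := by
    refine lintegral_congr fun ξ => ?_
    have h0 := besselSymbol_pos α ξ
    rw [ENNReal.rpow_two, ← ENNReal.ofReal_pow (by positivity), mul_pow, inv_pow,
      eq_inv_of_mul_eq_one_right (besselSymbol_sq_mul_invSymbol α ξ)]
  have hab : ‖∫ ξ, u ξ * 𝓕⁻ h (slotSum ξ)‖ₑ ≤ ∫⁻ ξ, (a * b) ξ := by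
    refine (enorm_integral_le_lintegral_enorm _).trans (le_of_eq (lintegral_congr fun ξ => ?_))
    have h0 := besselSymbol_pos α ξ
    rw [Pi.mul_apply, ← ENNReal.ofReal_mul (by positivity), ← ofReal_norm, norm_mul]
    congr 1
    field_simp
  have hCS := ENNReal.lintegral_mul_le_Lp_mul_Lq volume Real.HolderConjugate.two_two
    ham.aemeasurable hbm.aemeasurable
  rw [ha, hb] at hCS
  refine (pow_le_pow_left' (hab.trans hCS) 2).trans (le_of_eq ?_)
  rw [mul_pow, ← ENNReal.rpow_two, ← ENNReal.rpow_two, ← ENNReal.rpow_mul, ← ENNReal.rpow_mul]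
  norm_num

/-- The restriction of a Schwartz function to the diagonal is a Schwartz function. -/
lemma exists_schwartz_diag (hm : 1 ≤ m) (f : 𝓢(Rmn m n, ℂ)) :
    ∃ φ : 𝓢(Rn n, ℂ), ∀ x, φ x = f (diag m n x) := by
  set L : Rn n →L[ℝ] Rmn m n :=
    ((PiLp.continuousLinearEquiv 2 ℝ fun _ : Fin m => Rn n).symm : (Fin m → Rn n) →L[ℝ] Rmn m n).comp
      (ContinuousLinearMap.pi fun _ : Fin m => ContinuousLinearMap.id ℝ (Rn n))
  have hL : ∀ x, L x = diag m n x := fun x => rfl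
  have hanti : AntilipschitzWith 1 L := by
    refine ContinuousLinearMap.antilipschitz_of_bound L fun x => ?_
    change ‖x‖ ≤ ((1 : NNReal) : ℝ) * ‖L x‖
    rw [hL, NNReal.coe_one, one_mul]
    exact PiLp.norm_apply_le (diag m n x) ⟨0, hm⟩
  exact ⟨SchwartzMap.compCLMOfAntilipschitz ℂ L.hasTemperateGrowth hanti f, fun x => rfl⟩

/-! ### From the form bound to the trace bound -/

theorem diagonalTraceBound_of_formE_le (hm : 1 ≤ m) (hα : ∀ k, 0 < α k) {p q C : ℝ}
    (hpq : q.HolderConjugate p) (hq : 2 ≤ q) (hC : 0 ≤ C)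
    (hform : ∀ h : Rn n → ℂ, MemLp h (ENNReal.ofReal p) →
      formE α (fun x => ‖h x‖ₑ) ≤
        ENNReal.ofReal (C * (eLpNorm h (ENNReal.ofReal p) volume).toReal ^ 2)) :
    DiagonalTraceBound m n α q C := by
  intro f
  have hp0 : 0 < p := hpq.symm.pos
  have hq0 : 0 < q := hpq.pos
  obtain ⟨φ, hφ⟩ := exists_schwartz_diag hm f
  simp_rw [← hφ]
  set N := ∫ x, ‖φ x‖ ^ q with hN
  have hN0 : 0 ≤ N := integral_nonneg fun _ => by positivity
  have hΛ := lambdaStar_nonneg α f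
  -- The equality case of Hölder: `φ h = |φ|^q = |h|^p`. The condition `q ≥ 2` makes `h` continuous
  -- at the zeros of `φ`.
  set h : Rn n → ℂ := fun x => (starRingEnd ℂ) (φ x) * ((‖φ x‖ ^ (q - 2) : ℝ) : ℂ) with hh
  have hhc : Continuous h := by
    refine (Complex.continuous_conj.comp φ.continuous).mul (Complex.continuous_ofReal.comp ?_)
    exact φ.continuous.norm.rpow_const fun _ => Or.inr (by linarith)
  have hnorm : ∀ x, ‖h x‖ = ‖φ x‖ ^ (q - 1) := by
    intro x
    rw [hh]
    simp only
    rw [norm_mul, RCLike.norm_conj, Complex.norm_real, Real.norm_of_nonneg (by positivity),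
      show q - 1 = 1 + (q - 2) by ring, Real.rpow_add_of_nonneg (norm_nonneg _) zero_le_one
        (by linarith), Real.rpow_one]
  have hnormp : ∀ x, ‖h x‖ ^ p = ‖φ x‖ ^ q := by
    intro x
    rw [hnorm, ← Real.rpow_mul (norm_nonneg _), hpq.sub_one_mul_conj]
  have hmul : ∀ x, φ x * h x = ((‖φ x‖ ^ q : ℝ) : ℂ) := by
    intro x
    rw [hh]
    simp only
    rw [← mul_assoc, Complex.mul_conj', ← Complex.ofReal_pow, ← Complex.ofReal_mul,
      ← Real.rpow_natCast, ← Real.rpow_add_of_nonneg (norm_nonneg _) (by norm_num) (by linarith)]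
    norm_num
  have hφint : ∀ {r : ℝ}, 0 < r → Integrable fun x => ‖φ x‖ ^ r := by
    intro r hr
    have := (φ.memLp (ENNReal.ofReal r)).integrable_norm_rpow (by simpa using hr)
      ENNReal.ofReal_ne_top
    rwa [ENNReal.toReal_ofReal hr.le] at this
  have hhint : Integrable h := by
    refine (hφint (r := q - 1) (by linarith)).mono' hhc.aestronglyMeasurable
      (Filter.Eventually.of_forall fun x => (hnorm x).le)
  have hp' : ENNReal.ofReal p ≠ 0 := by simpa using hp0
  have hhp : MemLp h (ENNReal.ofReal p) := by
    rw [← integrable_norm_rpow_iff hhc.aestronglyMeasurable hp' ENNReal.ofReal_ne_top,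
      ENNReal.toReal_ofReal hp0.le]
    simp_rw [hnormp]
    exact hφint hq0
  have hT : (eLpNorm h (ENNReal.ofReal p) volume).toReal = N ^ p⁻¹ := by
    rw [hhp.eLpNorm_eq_integral_rpow_norm hp' ENNReal.ofReal_ne_top,
      ENNReal.toReal_ofReal hp0.le]
    simp_rw [hnormp]
    exact ENNReal.toReal_ofReal (by positivity)
  have hpair : ∫ x, f (diag m n x) * h x = (N : ℂ) := by
    simp_rw [← hφ, hmul]
    rw [integral_complex_ofReal]
  have key := (enorm_integral_diag_mul_sq_le (α := α) f hhint).trans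
    (mul_le_mul_right ((energyE_le_formE hα hhint).trans (hform h hhp)) _)
  rw [hpair, hT, ← ofReal_norm, Complex.norm_real, Real.norm_of_nonneg hN0,
    ← ENNReal.ofReal_pow hN0, ← ENNReal.ofReal_mul hΛ,
    ENNReal.ofReal_le_ofReal_iff (by positivity)] at key
  rcases hN0.eq_or_lt with h0 | h0
  · rw [← h0, Real.zero_rpow (by positivity)]
    positivity
  -- Here `key` reads `N² ≤ Λ_*(f) C N^{2/p}`, and `2 = 2/q + 2/p` lets `N^{2/p}` cancel.
  · have e : N ^ (2 : ℕ) = N ^ (2 / q) * (N ^ p⁻¹) ^ 2 := by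
      rw [← Real.rpow_natCast, ← Real.rpow_natCast, ← Real.rpow_mul h0.le, ← Real.rpow_add h0]
      congr 1
      have := hpq.inv_add_inv_eq_one
      push_cast
      rw [div_eq_mul_inv]
      linarith
    rw [e, ← mul_assoc, mul_comm (lambdaStar α f)] at key
    exact le_of_mul_le_mul_right key (by positivity)


/-! ### From the trace bound to the form bound -/

/-- A bump function has a nonzero trace, which a negative `C` would forbid. The equivalence is
claimed for every real `C`, while `ENNReal.ofReal` would truncate negative ones. -/
lemma nonneg_of_diagonalTraceBound (hm : 1 ≤ m) {q C : ℝ} (hq : 0 < q)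
    (h : DiagonalTraceBound m n α q C) : 0 ≤ C := by
  by_contra! hC
  set χ : ContDiffBump (0 : Rmn m n) := ⟨1, 2, one_pos, one_lt_two⟩
  have hcs : HasCompactSupport fun ξ : Rmn m n => ((χ ξ : ℝ) : ℂ) :=
    χ.hasCompactSupport.comp_left (g := fun t : ℝ => (t : ℂ)) Complex.ofReal_zero
  have hcd : ContDiff ℝ (⊤ : ℕ∞) fun ξ : Rmn m n => ((χ ξ : ℝ) : ℂ) :=
    Complex.ofRealCLM.contDiff.comp χ.contDiff
  set f : 𝓢(Rmn m n, ℂ) := hcs.toSchwartzMap hcd with hf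
  have hf0 : f (diag m n 0) = 1 := by
    change ((χ (0 : Rmn m n) : ℝ) : ℂ) = 1
    rw [χ.one_of_mem_closedBall (Metric.mem_closedBall_self χ.rIn_pos.le), Complex.ofReal_one]
  obtain ⟨φ, hφ⟩ := exists_schwartz_diag hm f
  have hpos : 0 < ∫ x, ‖φ x‖ ^ q := by
    have hint : Integrable fun x => ‖φ x‖ ^ q := by
      have := (φ.memLp (ENNReal.ofReal q)).integrable_norm_rpow (by simpa using hq)
        ENNReal.ofReal_ne_top
      rwa [ENNReal.toReal_ofReal hq.le] at this
    refine integral_pos_of_integrable_nonneg_nonzero (x := 0)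
      (φ.continuous.norm.rpow_const fun _ => Or.inr hq.le) hint (fun _ => by positivity) ?_
    simp [hφ, hf0]
  have h1 := h f
  simp_rw [← hφ] at h1
  have h2 : 0 < (∫ x, ‖φ x‖ ^ q) ^ (2 / q) := by positivity
  nlinarith [lambdaStar_nonneg α f]

/-- `ξ ↦ ȟ(ξ₁ + ⋯ + ξₘ)` is smooth if `h` is bounded with bounded support. -/
lemma contDiff_fourierInv_slotSum {h : Rn n → ℂ} (hm : AEStronglyMeasurable h) {M : ℝ}
    (hM : ∀ x, ‖h x‖ ≤ M) (hs : ∀ x, M < ‖x‖ → h x = 0) :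
    ContDiff ℝ (⊤ : ℕ∞) fun ξ : Rmn m n => 𝓕⁻ h (slotSum ξ) := by
  have hM0 : 0 ≤ M := (norm_nonneg _).trans (hM 0)
  have h1 : ContDiff ℝ (⊤ : ℕ∞) (𝓕 h) := by
    refine Real.contDiff_fourier fun k _ => ?_
    have hi : Integrable ((Metric.closedBall (0 : Rn n) M).indicator fun _ => M ^ k * M) :=
      (integrable_indicator_iff measurableSet_closedBall).2
        (integrableOn_const measure_closedBall_lt_top.ne)
    refine hi.mono' (by fun_prop) (Filter.Eventually.of_forall fun x => ?_)
    rw [Real.norm_of_nonneg (by positivity)]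
    by_cases hx : ‖x‖ ≤ M
    · rw [Set.indicator_of_mem (by simpa using hx)]
      gcongr
      exact hM x
    · rw [hs x (not_le.1 hx), norm_zero, mul_zero]
      exact Set.indicator_nonneg (fun _ _ => by positivity) _
  have h2 : ContDiff ℝ (⊤ : ℕ∞) fun ξ : Rmn m n => -slotSum ξ := by
    refine ContDiff.neg (ContDiff.sum fun k _ => ?_)
    exact (PiLp.proj 2 (𝕜 := ℝ) (fun _ => Rn n) k).contDiff
  simp_rw [Real.fourierInv_eq_fourier_neg]
  exact h1.comp h2

/-- Bounded support makes `ȟ` smooth, so a cutoff of the Cauchy–Schwarz extremal is the Fourier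
transform of an admissible Schwartz `f`. The single `M` bounds both the values and the support of
`g`. -/
lemma formE_le_of_bounded (hm : 1 ≤ m) (hα : ∀ k, 0 < α k) {p q C : ℝ}
    (hpq : q.HolderConjugate p) (hC : 0 ≤ C)
    (htr : DiagonalTraceBound m n α q C) {g : Rn n → ℝ} (hg : Measurable g) (hg0 : ∀ x, 0 ≤ g x)
    {M : ℝ} (hM : ∀ x, g x ≤ M) (hs : ∀ x, M < ‖x‖ → g x = 0) :
    formE α (fun x => ‖g x‖ₑ) ≤
      ENNReal.ofReal (C * (eLpNorm g (ENNReal.ofReal p) volume).toReal ^ 2) := by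
  have hp0 : 0 < p := hpq.symm.pos
  have hq0 : 0 < q := hpq.pos
  have hp' : ENNReal.ofReal p ≠ 0 := by simpa using hp0
  have hM0 : 0 ≤ M := (hg0 0).trans (hM 0)
  have hgb : ∀ x, ‖g x‖ ≤ (Metric.closedBall (0 : Rn n) M).indicator (fun _ => M) x := by
    intro x
    rw [Real.norm_of_nonneg (hg0 x)]
    by_cases hx : ‖x‖ ≤ M
    · rw [Set.indicator_of_mem (by simpa using hx)]; exact hM x
    · rw [hs x (not_le.1 hx)]; exact Set.indicator_nonneg (fun _ _ => hM0) _
  have hgp : ∀ r : ℝ≥0∞, MemLp g r := fun r =>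
    (memLp_indicator_const r measurableSet_closedBall M
      (Or.inr measure_closedBall_lt_top.ne)).mono' hg.aestronglyMeasurable
      (Filter.Eventually.of_forall hgb)
  have hgi : Integrable g := memLp_one_iff_integrable.1 (hgp 1)
  set h : Rn n → ℂ := fun x => (g x : ℂ) with hh
  have hhi : Integrable h := hgi.ofReal
  set H : Rmn m n → ℂ := fun ξ => 𝓕⁻ h (slotSum ξ) with hH
  have hHs : ContDiff ℝ (⊤ : ℕ∞) H := contDiff_fourierInv_slotSum hhi.1 (M := M)
    (fun x => by rw [hh]; simpa [Complex.norm_real, abs_of_nonneg (hg0 x)] using hM x)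
    (fun x hx => by rw [hh]; simp [hs x hx])
  set T := (eLpNorm g (ENNReal.ofReal p) volume).toReal with hT
  have hTeq : T = (∫ x, g x ^ p) ^ (1 / p) := by
    rw [hT, (hgp _).eLpNorm_eq_integral_rpow_norm hp' ENNReal.ofReal_ne_top,
      ENNReal.toReal_ofReal hp0.le, ENNReal.toReal_ofReal (by positivity), one_div]
    simp_rw [Real.norm_of_nonneg (hg0 _)]
  have hT0 : 0 ≤ T := ENNReal.toReal_nonneg
  have main : ∀ R : ℝ, 0 < R → ∫⁻ ξ in Metric.closedBall (0 : Rmn m n) R,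
      ENNReal.ofReal (invSymbol α ξ * ‖H ξ‖ ^ 2) ≤ ENNReal.ofReal (C * T ^ 2) := by
    intro R hR
    set χ : ContDiffBump (0 : Rmn m n) := ⟨R, R + 1, hR, by linarith⟩
    -- With `f̂ = G₀`, the pairing of the trace with `h` is `A = ∫ χ invSymbol |H|²`, while `Λ_*(f)
    -- = ∫ χ² invSymbol |H|² ≤ A` because `χ ≤ 1`.
    set G₀ : Rmn m n → ℂ := fun ξ => ((χ ξ * invSymbol α ξ : ℝ) : ℂ) * (starRingEnd ℂ) (H ξ)
    have hcs : HasCompactSupport G₀ := by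
      refine HasCompactSupport.mul_right ?_
      exact (χ.hasCompactSupport.mul_right (f' := invSymbol α)).comp_left
        (g := fun t : ℝ => (t : ℂ)) Complex.ofReal_zero
    have hcd : ContDiff ℝ (⊤ : ℕ∞) G₀ :=
      (Complex.ofRealCLM.contDiff.comp (χ.contDiff.mul (contDiff_invSymbol α))).mul
        (Complex.conjCLE.contDiff.comp hHs)
    set G : 𝓢(Rmn m n, ℂ) := hcs.toSchwartzMap hcd
    have hG : ∀ ξ, G ξ = G₀ ξ := fun ξ => rfl
    set f : 𝓢(Rmn m n, ℂ) := 𝓕⁻ G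
    have hFf : 𝓕 (f : Rmn m n → ℂ) = G₀ := by
      rw [← SchwartzMap.fourier_coe]
      change ((𝓕 (𝓕⁻ G) : 𝓢(Rmn m n, ℂ)) : Rmn m n → ℂ) = G₀
      rw [FourierTransform.fourier_fourierInv_eq]
      rfl
    obtain ⟨φ, hφ⟩ := exists_schwartz_diag hm f
    set e : Rmn m n → ℝ := fun ξ => χ ξ * invSymbol α ξ * ‖H ξ‖ ^ 2
    have he0 : ∀ ξ, 0 ≤ e ξ := fun ξ =>
      mul_nonneg (mul_nonneg χ.nonneg (invSymbol_pos α ξ).le) (sq_nonneg _)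
    have hec : Continuous e :=
      (χ.continuous.mul (contDiff_invSymbol α).continuous).mul (hHs.continuous.norm.pow 2)
    have hei : Integrable e := by
      refine hec.integrable_of_hasCompactSupport ?_
      exact (χ.hasCompactSupport.mul_right (f' := invSymbol α)).mul_right
    set A := ∫ ξ, e ξ with hA
    have hA0 : 0 ≤ A := integral_nonneg he0
    have hpair : ∫ x, φ x * h x = (A : ℂ) := by
      simp_rw [hφ]
      rw [integral_diag_mul f hhi, hFf, hA, ← integral_complex_ofReal]
      refine integral_congr_ae (Filter.Eventually.of_forall fun ξ => ?_)
      simp only [G₀, e, hH]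
      rw [mul_assoc, Complex.conj_mul']
      push_cast
      ring
    have hΛ : lambdaStar α f ≤ A := by
      rw [lambdaStar_eq, hFf]
      refine integral_mono_of_nonneg (Filter.Eventually.of_forall fun ξ => by positivity) hei
        (Filter.Eventually.of_forall fun ξ => ?_)
      have h1 := invSymbol_pos α ξ
      have h2 := besselSymbol_sq_mul_invSymbol α ξ
      have h3 : 0 ≤ χ ξ := χ.nonneg
      simp only [G₀, e]
      rw [norm_mul, RCLike.norm_conj, Complex.norm_real, Real.norm_of_nonneg (by positivity)]
      calc _ = (besselSymbol α ξ ^ 2 * invSymbol α ξ) * (χ ξ * (χ ξ * invSymbol α ξ * ‖H ξ‖ ^ 2)) :=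
            by ring
        _ ≤ _ := by
            rw [h2, one_mul]
            exact mul_le_of_le_one_left (he0 ξ) χ.le_one
    have hHol : A ≤ (∫ x, ‖φ x‖ ^ q) ^ (1 / q) * T := by
      rw [hTeq]
      refine le_trans ?_ (integral_mul_le_Lp_mul_Lq_of_nonneg hpq
        (Filter.Eventually.of_forall fun x => norm_nonneg (φ x))
        (Filter.Eventually.of_forall hg0) (φ.memLp _).norm (hgp _))
      have h1 : A = ‖∫ x, φ x * h x‖ := by
        rw [hpair, Complex.norm_real, Real.norm_of_nonneg hA0]
      rw [h1]
      refine (norm_integral_le_integral_norm _).trans (le_of_eq ?_)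
      refine integral_congr_ae (Filter.Eventually.of_forall fun x => ?_)
      simp only [hh]
      rw [norm_mul, Complex.norm_real, Real.norm_of_nonneg (hg0 x)]
    have htrf := htr f
    simp_rw [← hφ] at htrf
    have hI0 : 0 ≤ ∫ x, ‖φ x‖ ^ q := integral_nonneg fun _ => by positivity
    have hAT : A ≤ C * T ^ 2 := by
      rcases hA0.eq_or_lt with h0 | h0
      · rw [← h0]; positivity
      -- Hölder and the trace bound give `A² ≤ C Λ_*(f) T² ≤ C A T²`. The integral `A` is finite
      -- thanks to the cutoff, so one factor cancels, uniformly in `R`.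
      · have h1 : A ^ 2 ≤ (C * T ^ 2) * A := by
          calc A ^ 2 ≤ ((∫ x, ‖φ x‖ ^ q) ^ (1 / q) * T) ^ 2 := by gcongr
            _ = (∫ x, ‖φ x‖ ^ q) ^ (2 / q) * T ^ 2 := by
                rw [mul_pow, ← Real.rpow_natCast, ← Real.rpow_mul hI0]
                congr 2
                push_cast; ring
            _ ≤ (C * A) * T ^ 2 := by
                gcongr
                exact htrf.trans (mul_le_mul_of_nonneg_left hΛ hC)
            _ = _ := by ring
        rw [sq] at h1
        exact le_of_mul_le_mul_right h1 h0
    calc _ ≤ ∫⁻ ξ in Metric.closedBall (0 : Rmn m n) R, ENNReal.ofReal (e ξ) := by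
          refine setLIntegral_mono' measurableSet_closedBall fun ξ hξ => le_of_eq ?_
          simp only [e]
          rw [χ.one_of_mem_closedBall hξ, one_mul]
      _ ≤ ∫⁻ ξ, ENNReal.ofReal (e ξ) := setLIntegral_le_lintegral _ _
      _ = ENNReal.ofReal A :=
          (ofReal_integral_eq_lintegral_ofReal hei (Filter.Eventually.of_forall he0)).symm
      _ ≤ _ := ENNReal.ofReal_le_ofReal hAT
  rw [← energyE_eq_formE hα hgi hg0]
  have hcov := (aecover_closedBall (μ := (volume : Measure (Rmn m n))) (x := 0)
    (r := fun N : ℕ => (N : ℝ) + 1) (l := Filter.atTop)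
    (Filter.tendsto_atTop_add_const_right _ _ tendsto_natCast_atTop_atTop))
  have hmeas : AEMeasurable (fun ξ : Rmn m n => ENNReal.ofReal (invSymbol α ξ * ‖H ξ‖ ^ 2)) :=
    ((contDiff_invSymbol α).continuous.mul
      (hHs.continuous.norm.pow 2)).measurable.ennreal_ofReal.aemeasurable
  refine le_of_tendsto' (hcov.lintegral_tendsto_of_countably_generated hmeas) fun N => ?_
  exact main _ (by positivity)

lemma formE_enorm_congr_ae {f g : Rn n → ℂ} (h : f =ᵐ[volume] g) :
    formE α (fun x => ‖f x‖ₑ) = formE α (fun x => ‖g x‖ₑ) := by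
  refine lintegral_congr_ae ?_
  filter_upwards [Measure.quasiMeasurePreserving_fst.ae h,
    Measure.quasiMeasurePreserving_snd.ae h] with z h1 h2
  rw [h1, h2]

theorem formE_le_of_diagonalTraceBound (hm : 1 ≤ m) (hα : ∀ k, 0 < α k) {p q C : ℝ}
    (hpq : q.HolderConjugate p) (hC : 0 ≤ C)
    (htr : DiagonalTraceBound m n α q C) {h : Rn n → ℂ} (hh : MemLp h (ENNReal.ofReal p)) :
    formE α (fun x => ‖h x‖ₑ) ≤
      ENNReal.ofReal (C * (eLpNorm h (ENNReal.ofReal p) volume).toReal ^ 2) := by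
  set u := hh.1.mk h
  have hu : StronglyMeasurable u := hh.1.stronglyMeasurable_mk
  have hhu : h =ᵐ[volume] u := hh.1.ae_eq_mk
  have hup : MemLp u (ENNReal.ofReal p) := (memLp_congr_ae hhu).1 hh
  have hum := hu.measurable
  rw [formE_enorm_congr_ae hhu, eLpNorm_congr_ae hhu]
  -- Truncating `|u|` in height and in support at the same level `N` meets the hypotheses of
  -- `formE_le_of_bounded` with `M = N`. The forms then converge monotonically.
  set g : ℕ → Rn n → ℝ := fun N =>
    (Metric.closedBall (0 : Rn n) N).indicator fun x => min ‖u x‖ N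
  have hgm : ∀ N, Measurable (g N) := fun N =>
    Measurable.indicator (by fun_prop) measurableSet_closedBall
  have hg0 : ∀ N x, 0 ≤ g N x := fun N x => Set.indicator_nonneg (fun _ _ => by positivity) x
  have hgu : ∀ N x, g N x ≤ ‖u x‖ := fun N x =>
    Set.indicator_le' (fun _ _ => min_le_left _ _) (fun _ _ => norm_nonneg _) x
  have hgN : ∀ N x, g N x ≤ N := fun N x =>
    Set.indicator_le' (fun _ _ => min_le_right _ _) (fun _ _ => by positivity) x
  have hmono : ∀ x, Monotone fun N => g N x := by
    intro x N N' hN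
    have hN' : (N : ℝ) ≤ N' := by exact_mod_cast hN
    simp only [g]
    by_cases hx : x ∈ Metric.closedBall (0 : Rn n) N
    · rw [Set.indicator_of_mem hx, Set.indicator_of_mem (Metric.closedBall_subset_closedBall hN' hx)]
      gcongr
    · rw [Set.indicator_of_notMem hx]
      exact hg0 N' x
  have heventually : ∀ x, ∀ᶠ N in Filter.atTop, g N x = ‖u x‖ := by
    intro x
    filter_upwards [Filter.eventually_ge_atTop ⌈max ‖x‖ ‖u x‖⌉₊] with N hN
    have h1 : max ‖x‖ ‖u x‖ ≤ N := Nat.ceil_le.1 hN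
    simp only [g]
    rw [Set.indicator_of_mem (by simpa using (le_max_left _ _).trans h1),
      min_eq_left ((le_max_right _ _).trans h1)]
  have hKm := measurable_kernelE (n := n) hα
  refine le_of_tendsto' (lintegral_tendsto_of_tendsto_of_monotone
    (f := fun N (z : Rn n × Rn n) => ‖g N z.1‖ₑ * kernelE n α (z.1 - z.2) * ‖g N z.2‖ₑ)
    (fun N => ?_) (Filter.Eventually.of_forall fun z => ?_)
    (Filter.Eventually.of_forall fun z => ?_)) fun N => ?_
  · have := hgm N
    exact Measurable.aemeasurable (by fun_prop)
  · intro N N' hN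
    simp only [Real.enorm_of_nonneg (hg0 _ _)]
    gcongr <;> exact hmono _ hN
  · refine tendsto_const_nhds.congr' ?_
    filter_upwards [heventually z.1, heventually z.2] with N h1 h2
    rw [h1, h2, enorm_norm, enorm_norm]
  · refine (formE_le_of_bounded hm hα hpq hC htr (hgm N) (hg0 N) (hgN N) fun x hx => ?_).trans ?_
    · exact Set.indicator_of_notMem (by simpa using hx) _
    · apply ENNReal.ofReal_le_ofReal
      gcongr
      · exact hup.2.ne
      · exact eLpNorm_mono fun x => by
          rw [Real.norm_of_nonneg (hg0 N x)]; exact hgu N x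

/-! ### Passage between the complex bilinear form and `formE` -/

lemma enorm_form_integrand_ae (hm : 1 ≤ m) (hn : 1 ≤ n) (hα : ∀ k, 0 < α k ∧ α k < n)
    (h : Rn n → ℂ) :
    ∀ᵐ z : Rn n × Rn n, ‖h z.1 * ((∏ k, besselG n (α k) (z.1 - z.2) : ℝ) : ℂ) * h z.2‖ₑ =
      ‖h z.1‖ₑ * kernelE n α (z.1 - z.2) * ‖h z.2‖ₑ := by
  filter_upwards [(quasiMeasurePreserving_sub (volume : Measure (Rn n)) volume).ae
    (ae_ne_zero hn)] with z hz
  have h0 : 0 ≤ ∏ k, besselG n (α k) (z.1 - z.2) := Finset.prod_nonneg fun k _ => by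
    rw [besselG_eq_toReal n (hα k).1]; exact ENNReal.toReal_nonneg
  rw [enorm_mul, enorm_mul, ← ofReal_norm (Complex.ofReal _), Complex.norm_real,
    Real.norm_of_nonneg h0, ofReal_prod_besselG (fun k => (hα k).1) (kernelE_ne_top hm hα hz)]

lemma aestronglyMeasurable_form_integrand (hα : ∀ k, 0 < α k) {h : Rn n → ℂ}
    (hh : AEStronglyMeasurable h) :
    AEStronglyMeasurable (fun z : Rn n × Rn n =>
      h z.1 * ((∏ k, besselG n (α k) (z.1 - z.2) : ℝ) : ℂ) * h z.2) (volume.prod volume) := by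
  have hG : ∀ k, Measurable (besselG n (α k)) := fun k => by
    rw [show besselG n (α k) = fun x => (besselE n (α k) x).toReal from
      funext (besselG_eq_toReal n (hα k))]
    exact (measurable_besselE n (hα k)).ennreal_toReal
  refine (hh.comp_fst.mul ?_).mul hh.comp_snd
  exact Measurable.aestronglyMeasurable (by fun_prop)

/-- The kernel is nonnegative, so testing with `|h|` gives the absolute integral, and that in turn
controls every complex `h`. The indicator of the unit ball forces `0 ≤ C`. -/
lemma besselFormBound_iff (hm : 1 ≤ m) (hn : 1 ≤ n) (hα : ∀ k, 0 < α k ∧ α k < n) {p C : ℝ}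
    (hp : 0 < p) :
    BesselFormBound m n α p C ↔ 0 ≤ C ∧ ∀ h : Rn n → ℂ, MemLp h (ENNReal.ofReal p) →
      formE α (fun x => ‖h x‖ₑ) ≤
        ENNReal.ofReal (C * (eLpNorm h (ENNReal.ofReal p) volume).toReal ^ 2) := by
  have hp' : ENNReal.ofReal p ≠ 0 := by simpa using hp
  constructor
  · intro H
    refine ⟨?_, fun h hh => ?_⟩
    · set h : Rn n → ℂ := (Metric.ball (0 : Rn n) 1).indicator fun _ => 1
      have hh : MemLp h (ENNReal.ofReal p) := memLp_indicator_const _ measurableSet_ball _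
        (Or.inr measure_ball_lt_top.ne)
      have h1 := (norm_nonneg _).trans (H h hh).2
      have hT : 0 < (eLpNorm h (ENNReal.ofReal p) volume).toReal := by
        refine ENNReal.toReal_pos ?_ hh.2.ne
        rw [eLpNorm_indicator_const measurableSet_ball hp' ENNReal.ofReal_ne_top]
        have := (Metric.measure_ball_pos (volume : Measure (Rn n)) 0 one_pos)
        simp [this.ne', ENNReal.rpow_eq_zero_iff, measure_ball_lt_top.ne]
      exact nonneg_of_mul_nonneg_left h1 (by positivity)
    · set h' : Rn n → ℂ := fun x => ((‖h x‖ : ℝ) : ℂ) with hh'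
      have hmem : MemLp h' (ENNReal.ofReal p) := hh.norm.ofReal
      have hnorm : ∀ x, ‖h' x‖ = ‖h x‖ := fun x => by simp [hh']
      obtain ⟨hi, hb⟩ := H h' hmem
      have heL : eLpNorm h' (ENNReal.ofReal p) volume = eLpNorm h (ENNReal.ofReal p) volume :=
        eLpNorm_congr_norm_ae (Filter.Eventually.of_forall hnorm)
      rw [heL] at hb
      have e : ∀ z : Rn n × Rn n, h' z.1 * ((∏ k, besselG n (α k) (z.1 - z.2) : ℝ) : ℂ) * h' z.2 =
          ((‖h' z.1 * ((∏ k, besselG n (α k) (z.1 - z.2) : ℝ) : ℂ) * h' z.2‖ : ℝ) : ℂ) := by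
        intro z
        have h0 : 0 ≤ ∏ k, besselG n (α k) (z.1 - z.2) := Finset.prod_nonneg fun k _ => by
          rw [besselG_eq_toReal n (hα k).1]; exact ENNReal.toReal_nonneg
        rw [norm_mul, norm_mul, hnorm, hnorm, Complex.norm_real, Real.norm_of_nonneg h0,
          Complex.ofReal_mul, Complex.ofReal_mul]
      rw [integral_congr_ae (Filter.Eventually.of_forall e), integral_complex_ofReal,
        Complex.norm_real, Real.norm_of_nonneg (integral_nonneg fun _ => norm_nonneg _)] at hb
      refine le_trans (le_of_eq ?_) (ENNReal.ofReal_le_ofReal hb)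
      rw [ofReal_integral_norm_eq_lintegral_enorm hi]
      refine lintegral_congr_ae ?_
      filter_upwards [enorm_form_integrand_ae hm hn hα h'] with z hz
      rw [hz, ← ofReal_norm (h' z.1), ← ofReal_norm (h' z.2), hnorm, hnorm, ofReal_norm,
        ofReal_norm]
  · rintro ⟨hC, H⟩ h hh
    have h1 : ∫⁻ z : Rn n × Rn n,
        ‖h z.1 * ((∏ k, besselG n (α k) (z.1 - z.2) : ℝ) : ℂ) * h z.2‖ₑ ∂(volume.prod volume) ≤
        ENNReal.ofReal (C * (eLpNorm h (ENNReal.ofReal p) volume).toReal ^ 2) :=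
      (le_of_eq (lintegral_congr_ae (enorm_form_integrand_ae hm hn hα h))).trans (H h hh)
    refine ⟨⟨aestronglyMeasurable_form_integrand (fun k => (hα k).1) hh.1,
      h1.trans_lt ENNReal.ofReal_lt_top⟩, ?_⟩
    have h2 := (enorm_integral_le_lintegral_enorm _).trans h1
    rw [← ofReal_norm] at h2
    exact (ENNReal.ofReal_le_ofReal_iff (by positivity)).1 h2

theorem exists_besselFormBound (hm : 1 ≤ m) (hn : 1 ≤ n) (hα : ∀ k, 0 < α k ∧ α k < n)
    (hsum : (m : ℝ) * n - ∑ k, α k < n) {p q : ℝ} (hpq : q.HolderConjugate p)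
    (hq : 2 ≤ q) (hq' : (m : ℝ) * n - ∑ k, α k ≤ 2 * n / q) :
    ∃ C : ℝ, 0 < C ∧ BesselFormBound m n α p C := by
  have hp0 : 0 < p := hpq.symm.pos
  have hp' : ENNReal.ofReal p ≠ 0 := by simpa using hp0
  obtain ⟨D, hD, H⟩ := exists_formE_le hm hn hα hsum hpq hq hq'
  have hD0 : 0 < D.toReal + 1 := by positivity
  refine ⟨D.toReal + 1, hD0, (besselFormBound_iff hm hn hα hp0).2 ⟨hD0.le, fun h hh => ?_⟩⟩
  set u := hh.1.mk h
  have hhu : h =ᵐ[volume] u := hh.1.ae_eq_mk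
  have hup : MemLp u (ENNReal.ofReal p) := (memLp_congr_ae hhu).1 hh
  rw [formE_enorm_congr_ae hhu, eLpNorm_congr_ae hhu]
  have e : eLpNorm u (ENNReal.ofReal p) volume = (∫⁻ x, ‖u x‖ₑ ^ p) ^ (1 / p) := by
    rw [eLpNorm_eq_lintegral_rpow_enorm_toReal hp' ENNReal.ofReal_ne_top,
      ENNReal.toReal_ofReal hp0.le]
  have hfin : ∫⁻ x, ‖u x‖ₑ ^ p ≠ ∞ := by
    have := lintegral_rpow_enorm_lt_top_of_eLpNorm_lt_top hp' ENNReal.ofReal_ne_top hup.2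
    rw [ENNReal.toReal_ofReal hp0.le] at this
    exact this.ne
  refine (H _ hh.1.stronglyMeasurable_mk.measurable.enorm (fun _ => enorm_ne_top) hfin).trans ?_
  rw [← e, ENNReal.ofReal_mul hD0.le, ENNReal.ofReal_pow ENNReal.toReal_nonneg,
    ENNReal.ofReal_toReal hup.2.ne]
  gcongr
  exact (ENNReal.le_ofReal_iff_toReal_le hD hD0.le).2 (by linarith)

end BesselTrace

end

theorem mainTheorem3 (m n : ℕ) (hm : 1 ≤ m) (α : Fin m → ℝ)
    (hα : ∀ k, 0 < α k ∧ α k < n)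
    (hsum : (m : ℝ) * n - ∑ k, α k < n)
    (p q : ℝ) (hpq : 1 / q + 1 / p = 1)
    (hq : 2 ≤ q) (hq' : q ≤ 2 * n / ((m : ℝ) * n - ∑ k, α k)) :
    (∃ C : ℝ, 0 < C ∧ DiagonalTraceBound m n α q C ∧ BesselFormBound m n α p C) ∧
    (∀ C : ℝ, DiagonalTraceBound m n α q C ↔ BesselFormBound m n α p C) := by
  have hq0 : 0 < q := by linarith
  have hconj : q.HolderConjugate p :=
    Real.holderConjugate_iff.2 ⟨by linarith, by simpa [one_div] using hpq⟩
  have hn : 1 ≤ n := by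
    have h := hα ⟨0, hm⟩
    have h0 : (0 : ℝ) < n := h.1.trans h.2
    exact_mod_cast h0
  -- Positivity of `mn - α` follows from `αₖ < n` and `m ≥ 1`; it allows the bound on `q` to be
  -- rewritten as `mn - α ≤ 2n/q`.
  have hβ : 0 < (m : ℝ) * n - ∑ k, α k := by
    have h : ∑ k, α k < ∑ _k : Fin m, (n : ℝ) :=
      Finset.sum_lt_sum_of_nonempty ⟨⟨0, hm⟩, Finset.mem_univ _⟩ fun k _ => (hα k).2
    simp only [Finset.sum_const, Finset.card_univ, Fintype.card_fin, nsmul_eq_mul] at h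
    linarith
  have hβq : (m : ℝ) * n - ∑ k, α k ≤ 2 * n / q := by
    rw [le_div_iff₀ hβ] at hq'
    rw [le_div_iff₀ hq0]
    linarith
  have hiff : ∀ C : ℝ, DiagonalTraceBound m n α q C ↔ BesselFormBound m n α p C := by
    intro C
    rw [BesselTrace.besselFormBound_iff hm hn hα hconj.symm.pos]
    constructor
    · intro h
      have hC := BesselTrace.nonneg_of_diagonalTraceBound hm hq0 h
      exact ⟨hC, fun g hg =>
        BesselTrace.formE_le_of_diagonalTraceBound hm (fun k => (hα k).1) hconj hC h hg⟩
    · rintro ⟨hC, h⟩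
      exact BesselTrace.diagonalTraceBound_of_formE_le hm (fun k => (hα k).1) hconj hq hC h
  obtain ⟨C, hC, h⟩ := BesselTrace.exists_besselFormBound hm hn hα hsum hconj hq hβq
  exact ⟨⟨C, hC, (hiff C).2 h, h⟩, hiff⟩
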